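/- Let $\Omega=\{-1,+1\}^{\mathbb N}$ carry the product $\sigma$-algebra and the product measure $P=(\frac12\delta_{-1}+\frac12\delta_{+1})^{\otimes\mathbb N}$, with coordinates $X_k(\omega)=\omega_k$. A kernel of order $n$ is a square-summable symmetric function $f_n:\mathbb N^n\to\mathbb R$ vanishing whenever two of its arguments coincide (a constant if $n=0$), and $$J_n(f_n)=n!\sum_{i_1<\dots<i_n}f_n(i_1,\dots,i_n)X_{i_1}\cdots X_{i_n},\qquad J_0(c)=c .$$ Every $F\in L^2(\Omega)$ has a unique decomposition $F=\sum_{n\ge0}J_n(f_n)$ in $L^2(\Omega)$ with kernels $f_n$. Let $\mathrm{dom}(D)$ be the set of those $F$ with $\sum_{n\ge 1} n\,n!\,\|f_n\|^2_{\ell^2(\mathbb N^n)}<\infty$. For $F\in\mathrm{dom}(D)$ let $D_kF=\sum_{n\ge1}nJ_{n-1}(f_n(\cdot,k))$, $k\in\mathbb N$; for $F\in L^2(\Omega)\setminus\mathrm{dom}(D)$ let $D_kF(\omega)=\frac12(F(\omega_k^+)-F(\omega_k^-))$, where $\omega_k^\pm$ is $\omega$ with its $k$-th coordinate replaced by $\pm1$.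 For centred $F\in L^2(\Omega)$ let $L^{-1}F=-\sum_{n\ge1}\frac1nJ_n(f_n)$. Write $DF=(D_kF)_{k\in\mathbb N}$, let products, powers and absolute values of sequences be taken entrywise, and let $\langle u,v\rangle=\sum_k u_kv_k$. **Theorem.** Let $F\in\mathrm{dom}(D)$ with $\mathbb E[F]=0$ and let $N$ be a standard Gaussian random variable. Then the series $\langle DF,-DL^{-1}F\rangle$ converges absolutely almost surely; for every $x\in\mathbb R$, almost surely $(D_kF)(D_k\mathbf 1_{\{F>x\}})\ge0$ for all $k$; and $$\begin{aligned} \sup_{x\in\mathbb R}|P(F\le x)-P(N\le x)|\le{}&\mathbb E\big|1-\langle DF,-DL^{-1}F\rangle\big|+\frac{\sqrt{2\pi}}4\,\mathbb E\langle(DF)^2,|DL^{-1}F|\rangle\\ &+\mathbb E\langle(DF)^2,|F\cdot DL^{-1}F|\rangle+2\sup_{x\in\mathbb R}\mathbb E\langle(DF)\,D\mathbf 1_{\{F>x\}},|DL^{-1}F|\rangle , \end{aligned}$$ where the last three terms, whose summands are almost surely nonnegative, may take the value $+\infty$. -/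

import Mathlib

open MeasureTheory ProbabilityTheory Filter
open scoped ENNReal Nat Topology

noncomputable section

namespace Rademacher

/-- The canonical space of sign sequences; `ℤˣ` is the two-point set of signs. -/
abbrev Space : Type := ℕ → ℤˣ

/-- The symmetric law on the two signs. -/
def signLaw : Measure ℤˣ :=
  (1 / 2 : ℝ≥0∞) • Measure.dirac (-1) + (1 / 2 : ℝ≥0∞) • Measure.dirac 1

instance signLaw_isProbabilityMeasure : IsProbabilityMeasure signLaw := by
  constructor
  simp [signLaw, ENNReal.inv_two_add_inv_two]

/-- The infinite product of the symmetric law. -/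
def P : Measure Space := Measure.infinitePi (fun _ : ℕ => signLaw)

instance P_isProbabilityMeasure : IsProbabilityMeasure P := by
  unfold P; infer_instance

/-- The canonical Rademacher sequence, as real random variables. -/
def X (k : ℕ) (ω : Space) : ℝ := ((ω k : ℤ) : ℝ)

/-- The product `X_{i_1} ⋯ X_{i_q}`. -/
def walsh {q : ℕ} (i : Fin q → ℕ) (ω : Space) : ℝ := ∏ j, X (i j) ω

lemma measurable_X (k : ℕ) : Measurable (X k) := by
  have h : Measurable (fun u : ℤˣ => ((u : ℤ) : ℝ)) :=
    measurable_from_top.comp (comap_measurable (Units.val : ℤˣ → ℤ))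
  exact h.comp (measurable_pi_apply k)

lemma abs_X (k : ℕ) (ω : Space) : |X k ω| = 1 := by
  rcases Int.units_eq_one_or (ω k) with h | h <;> simp [X, h]

lemma memLp_walsh {q : ℕ} (i : Fin q → ℕ) : MemLp (walsh i) 2 P := by
  refine MemLp.of_bound (C := 1) ?_ (ae_of_all _ fun ω => ?_)
  · exact (Finset.measurable_prod _ fun j _ => measurable_X (i j)).aestronglyMeasurable
  · simp [walsh, abs_X]

/-- Square-summable symmetric kernels of order `q` that vanish on diagonals. For `q = 0` the
index set has one point, so a kernel is a real constant. -/
structure IsKernel (q : ℕ) (f : (Fin q → ℕ) → ℝ) : Prop where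
  summable_sq : Summable fun i => f i ^ 2
  symm : ∀ (σ : Equiv.Perm (Fin q)) (i : Fin q → ℕ), f (i ∘ σ) = f i
  diag : ∀ i : Fin q → ℕ, ¬ Function.Injective i → f i = 0

/-- The discrete multiple stochastic integral
`J_q(f) = q! ∑_{i_1 < ⋯ < i_q} f(i_1, …, i_q) X_{i_1} ⋯ X_{i_q}`; the series is summed in
`L²(P)`. -/
def J (q : ℕ) (f : (Fin q → ℕ) → ℝ) : Lp ℝ 2 P :=
  (q ! : ℝ) • ∑' i : Fin q ↪o ℕ, f i • (memLp_walsh (i : Fin q → ℕ)).toLp (walsh i)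

/-- `F` is square-integrable with chaotic decomposition `F = ∑_{n ≥ 0} J_n(f_n)` in `L²(P)`. -/
def HasChaos (F : Space → ℝ) (f : (n : ℕ) → (Fin n → ℕ) → ℝ) : Prop :=
  (∀ n, IsKernel n (f n)) ∧
    ∃ hF : MemLp F 2 P, HasSum (fun n => J n (f n)) (hF.toLp F)

open Classical in
/-- The kernels of the chaotic decomposition of `F` (which are unique). -/
def chaosKernel (F : Space → ℝ) : (n : ℕ) → (Fin n → ℕ) → ℝ :=
  if h : ∃ f, HasChaos F f then h.choose else fun _ _ => 0

/-- The domain of the gradient: `F = ∑ J_n(f_n)` with `∑ n n! ‖f_n‖² < ∞`. -/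
def domD : Set (Space → ℝ) :=
  {F | ∃ f, HasChaos F f ∧ Summable fun n : ℕ => (n : ℝ) * (n ! : ℝ) * ∑' i, f n i ^ 2}

/-- The gradient on its domain: `D_k F = ∑_{n ≥ 1} n J_{n-1}(f_n(·, k))`, summed in `L²(P)`
(the summation index below is `n - 1`). -/
def chaosGradient (F : Space → ℝ) (k : ℕ) : Lp ℝ 2 P :=
  ∑' n : ℕ, ((n : ℝ) + 1) •
    J n (fun i => chaosKernel F (n + 1) (Fin.snoc (α := fun _ => ℕ) i k))

/-- The pathwise gradient `D'_k F = (F_k^+ - F_k^-) / 2`. -/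
def pathGradient (F : Space → ℝ) (k : ℕ) (ω : Space) : ℝ :=
  (F (Function.update ω k 1) - F (Function.update ω k (-1))) / 2

open Classical in
/-- The discrete gradient: `D` on its domain, and the pathwise gradient `D'` elsewhere. -/
def D (F : Space → ℝ) (k : ℕ) : Space → ℝ :=
  if F ∈ domD then ⇑(chaosGradient F k) else pathGradient F k

/-- The pseudo-inverse of the Ornstein-Uhlenbeck operator on centred square-integrable
functionals: `L⁻¹ F = -∑_{n ≥ 1} (1/n) J_n(f_n)`, summed in `L²(P)` (the summation index below
is `n - 1`). -/
def Linv (F : Space → ℝ) : Space → ℝ :=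
  ⇑(-∑' n : ℕ, (1 / ((n : ℝ) + 1)) • J (n + 1) (chaosKernel F (n + 1)))

/-- The scalar product of `ℓ²(ℕ)`. -/
def inner2 (u v : ℕ → ℝ) : ℝ := ∑' k, u k * v k

/-- The scalar product of two real sequences with nonnegative products `u k * v k`, as a number
in `[0, ∞]`. -/
def innerNonneg (u v : ℕ → ℝ) : ℝ≥0∞ := ∑' k, ENNReal.ofReal (u k * v k)

/-- The indicator function of the event `{F > x}`. -/
def indGt (F : Space → ℝ) (x : ℝ) : Space → ℝ := {ω | F ω > x}.indicator fun _ => 1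

/-- The Kolmogorov distance between (the laws of) two real random variables. -/
def kolmogorovDist {Ω₁ Ω₂ : Type*} [MeasurableSpace Ω₁] [MeasurableSpace Ω₂]
    (Z : Ω₁ → ℝ) (μ : Measure Ω₁) (N : Ω₂ → ℝ) (ν : Measure Ω₂) : ℝ :=
  ⨆ x : ℝ, |μ.real {ω | Z ω ≤ x} - ν.real {ω | N ω ≤ x}|

end Rademacher

end

/-!
The space `Ω` is only used through the flips `τ_k`, which change the sign of the `k`-th coordinate
and preserve `P`. For every functional, the pathwise gradient is
`X_k (F - F ∘ τ_k) / 2` (`pathGradient_eq`). It is therefore a bounded operator on `L²(P)`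
(`gradLp`) that does not depend on the choice of a version, and the Walsh functions
`X_A = ∏_{j ∈ A} X_j`, indexed by the finite sets `A ⊆ ℕ`, are orthonormal because a flip changes
the sign of `X_A X_B` for `A ≠ B`.

Chaotic decompositions are Walsh expansions grouped by the size of `A`
(`hasSum_J_of_hasSum_walshLp`, `HasChaos.hasSum_walshLp`). Two facts follow. The gradient of
the statement is almost surely the pathwise gradient, inside and outside its domain
(`D_ae_eq_pathGradient`). And since `D_k^* D_k X_A = 1{k ∈ A} X_A`, summation over the pairs
`k ∈ A` gives `∑_k E[(D_k F)²] = ∑_A |A| ⟨X_A, F⟩² < ∞` on the domain, and the integration by parts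
`E[F G] = E⟨DG, -DL⁻¹F⟩` for centred `F` and arbitrary square-integrable `G`
(`hasSum_integral_pathGradient_Linv`).

The bound is Stein's method. Let `g` be the bounded solution of
`g'(w) - w g(w) = 1{w ≤ x} - Φ(x)`, which satisfies `0 ≤ g ≤ √(2π)/4` (`stein_le`) and
`|g'| ≤ 1` (`abs_steinDeriv_le`). With `G = g(F)` and the chain rule
`D_k g(F) = g'(F) D_k F + R_k`,
`P(F ≤ x) - Φ(x) = E[g'(F) (1 - ⟨DF, -DL⁻¹F⟩)] + ∑_k E[R_k D_k L⁻¹F]`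
(`hasSum_integral_chainRemainder`). By Stein's equation, `g'` is the sum of `w g(w)`, which has
increments of size at most `|t - a| (√(2π)/4 + |a|)` from the base point `a`, and of a jump at `x`.
Integrating these two parts over the segment between the two values of `F` yields
`|R_k| ≤ (D_k F)² (√(2π)/4 + |F|) + 2 (D_k F) (D_k 1{F > x})` (`abs_stein_taylor_le`,
`abs_chainRemainder_le`), which accounts for the last three terms.
-/

noncomputable section

namespace Rademacher

/-! ### Flipping a coordinate -/

/-- The transformation of the space of sign sequences that changes the sign of the `k`-th
coordinate. -/
def flip (k : ℕ) (ω : Space) : Space := Function.update ω k (-ω k)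

lemma measurePreserving_neg_signLaw : MeasurePreserving (fun u : ℤˣ => -u) signLaw signLaw := by
  have hm : Measurable (fun u : ℤˣ => -u) :=
    measurable_comap_iff.2 ((measurable_from_top (f := fun z : ℤ => -z)).comp
      (comap_measurable (Units.val : ℤˣ → ℤ)))
  refine ⟨hm, ?_⟩
  rw [signLaw, Measure.map_add _ _ hm, Measure.map_smul, Measure.map_smul,
    Measure.map_dirac' hm, Measure.map_dirac' hm, neg_neg, add_comm]

lemma measurePreserving_flip (k : ℕ) : MeasurePreserving (flip k) P P := by
  have key := Measure.infinitePi_map_pi (ι := ℕ) (X := fun _ => ℤˣ) (Y := fun _ => ℤˣ)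
    (μ := fun _ => signLaw) (f := fun i u => if i = k then -u else u)
    (fun i => by
      by_cases h : i = k
      · simpa [h] using measurePreserving_neg_signLaw.measurable
      · simpa only [h, if_false] using measurable_id')
  have hfun : (fun (ω : Space) i => if i = k then -ω i else ω i) = flip k := by
    funext ω i
    by_cases h : i = k
    · subst h; simp [flip]
    · simp [flip, h]
  refine ⟨?_, ?_⟩
  · rw [← hfun]
    refine measurable_pi_lambda _ fun i => ?_
    by_cases h : i = k
    · simp only [h, if_true]
      exact measurePreserving_neg_signLaw.measurable.comp (measurable_pi_apply k)
    · simpa [h] using measurable_pi_apply i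
  · rw [hfun] at key
    rw [P, key]
    congr 1
    funext i
    by_cases h : i = k
    · simpa [h] using measurePreserving_neg_signLaw.map_eq
    · simp [h]

lemma X_flip_self (k : ℕ) (ω : Space) : X k (flip k ω) = -X k ω := by simp [X, flip]

lemma X_flip_of_ne {j k : ℕ} (h : j ≠ k) (ω : Space) : X j (flip k ω) = X j ω := by
  simp [X, flip, h]

lemma X_mul_self (k : ℕ) (ω : Space) : X k ω * X k ω = 1 := by
  rw [← abs_mul_abs_self, abs_X, one_mul]

/-- The pathwise gradient through the flip, which, unlike `ω ↦ ω_k^±`, preserves the measure. -/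
lemma pathGradient_eq (F : Space → ℝ) (k : ℕ) (ω : Space) :
    pathGradient F k ω = X k ω * ((F ω - F (flip k ω)) / 2) := by
  rcases Int.units_eq_one_or (ω k) with h | h
  · have h1 : Function.update ω k 1 = ω := by rw [← h, Function.update_eq_self]
    have h2 : flip k ω = Function.update ω k (-1) := by rw [flip, h]
    rw [pathGradient, h1, h2, X, h]; simp
  · have h1 : Function.update ω k (-1) = ω := by rw [← h, Function.update_eq_self]
    have h2 : flip k ω = Function.update ω k 1 := by rw [flip, h, neg_neg]
    rw [pathGradient, h1, h2, X, h]; push_cast; ring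

lemma pathGradient_congr_ae {F G : Space → ℝ} (h : F =ᵐ[P] G) (k : ℕ) :
    pathGradient F k =ᵐ[P] pathGradient G k := by
  filter_upwards [h, (measurePreserving_flip k).quasiMeasurePreserving.ae h] with ω h1 h2
  rw [pathGradient_eq, pathGradient_eq, h1, h2]

lemma memLp_pathGradient {F : Space → ℝ} (hF : MemLp F 2 P) (k : ℕ) :
    MemLp (pathGradient F k) 2 P := by
  have h : MemLp (fun ω => (F ω - F (flip k ω)) / 2) 2 P := by
    simpa [div_eq_inv_mul] using
      (hF.sub (hF.comp_measurePreserving (measurePreserving_flip k))).const_mul (2⁻¹)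
  refine h.of_le ?_ (ae_of_all _ fun ω => ?_)
  · have := (measurable_X k).aestronglyMeasurable.mul (μ := P) h.1
    exact this.congr (ae_of_all _ fun ω => (pathGradient_eq F k ω).symm)
  · rw [pathGradient_eq, norm_mul, Real.norm_eq_abs (X k ω), abs_X, one_mul]

/-! ### Walsh functions -/

/-- The Walsh function `∏_{j ∈ A} X_j`. -/
def walshSet (A : Finset ℕ) (ω : Space) : ℝ := ∏ j ∈ A, X j ω

lemma walsh_eq_walshSet {q : ℕ} (i : Fin q ↪o ℕ) :
    walsh (i : Fin q → ℕ) = walshSet (Finset.univ.map i.toEmbedding) := by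
  funext ω
  simp [walsh, walshSet]

lemma measurable_walshSet (A : Finset ℕ) : Measurable (walshSet A) :=
  Finset.measurable_prod _ fun j _ => measurable_X j

lemma abs_walshSet (A : Finset ℕ) (ω : Space) : |walshSet A ω| = 1 := by
  simp [walshSet, Finset.abs_prod, abs_X]

lemma memLp_walshSet (A : Finset ℕ) : MemLp (walshSet A) 2 P :=
  MemLp.of_bound (measurable_walshSet A).aestronglyMeasurable 1
    (ae_of_all _ fun ω => by simp [abs_walshSet])

lemma walshSet_flip (A : Finset ℕ) (k : ℕ) (ω : Space) :
    walshSet A (flip k ω) = if k ∈ A then -walshSet A ω else walshSet A ω := by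
  have hne : ∀ B : Finset ℕ, k ∉ B → ∏ j ∈ B, X j (flip k ω) = ∏ j ∈ B, X j ω := fun B hB =>
    Finset.prod_congr rfl fun j hj => X_flip_of_ne (fun h => hB (by rwa [h] at hj)) ω
  split_ifs with h
  · rw [walshSet, walshSet, ← Finset.mul_prod_erase A _ h, ← Finset.mul_prod_erase A (X · ω) h,
      hne _ (Finset.notMem_erase k A), X_flip_self, neg_mul]
  · exact hne A h

lemma X_mul_walshSet {A : Finset ℕ} {k : ℕ} (h : k ∈ A) (ω : Space) :
    X k ω * walshSet A ω = walshSet (A.erase k) ω := by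
  rw [walshSet, walshSet, ← Finset.mul_prod_erase A _ h, ← mul_assoc, X_mul_self, one_mul]

/-- The Walsh functions as elements of `L²(P)`. -/
def walshLp (A : Finset ℕ) : Lp ℝ 2 P := (memLp_walshSet A).toLp (walshSet A)

/-- Two different Walsh functions are orthogonal, since the flip of a coordinate that enters only
one of them changes the sign of their product. -/
lemma integral_walshSet_mul_walshSet {A B : Finset ℕ} (h : A ≠ B) :
    ∫ ω, walshSet A ω * walshSet B ω ∂P = 0 := by
  obtain ⟨k, hk⟩ : ∃ k, ¬ (k ∈ A ↔ k ∈ B) := by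
    by_contra! hc
    exact h (Finset.ext hc)
  have hflip : ∀ ω, walshSet A (flip k ω) * walshSet B (flip k ω)
      = -(walshSet A ω * walshSet B ω) := by
    intro ω
    rw [walshSet_flip, walshSet_flip]
    by_cases h1 : k ∈ A <;> by_cases h2 : k ∈ B <;> simp [h1, h2] at hk ⊢
  have hm : AEStronglyMeasurable (fun ω => walshSet A ω * walshSet B ω)
      (Measure.map (flip k) P) :=
    ((measurable_walshSet A).mul (measurable_walshSet B)).aestronglyMeasurable
  have := integral_map (measurePreserving_flip k).measurable.aemeasurable hm
  rw [(measurePreserving_flip k).map_eq] at this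
  simp only [hflip, integral_neg] at this
  linarith

lemma inner_toLp {F G : Space → ℝ} (hF : MemLp F 2 P) (hG : MemLp G 2 P) :
    inner ℝ (hF.toLp F) (hG.toLp G) = ∫ ω, F ω * G ω ∂P := by
  rw [L2.inner_def]
  refine integral_congr_ae ?_
  filter_upwards [hF.coeFn_toLp, hG.coeFn_toLp] with ω h1 h2
  rw [h1, h2]
  simp [mul_comm]

lemma orthonormal_walshLp : Orthonormal ℝ walshLp := by
  rw [orthonormal_iff_ite]
  intro A B
  rw [walshLp, walshLp, inner_toLp]
  split_ifs with h
  · subst h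
    have : ∀ ω, walshSet A ω * walshSet A ω = 1 := fun ω => by
      rw [← abs_mul_abs_self, abs_walshSet, one_mul]
    simp [this]
  · exact integral_walshSet_mul_walshSet h

/-! ### The gradient as an operator on `L²` -/

/-- The pathwise gradient as a bounded operator on `L²(P)`. -/
def gradLp (k : ℕ) : Lp ℝ 2 P →L[ℝ] Lp ℝ 2 P :=
  LinearMap.mkContinuous
    { toFun := fun f => (memLp_pathGradient (Lp.memLp f) k).toLp (pathGradient f k)
      map_add' := fun f g => by
        rw [← MemLp.toLp_add]
        refine MemLp.toLp_congr _ _ ((pathGradient_congr_ae (Lp.coeFn_add f g) k).trans ?_)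
        exact ae_of_all _ fun ω => by simp [pathGradient]; ring
      map_smul' := fun c f => by
        rw [RingHom.id_apply, ← MemLp.toLp_const_smul]
        refine MemLp.toLp_congr _ _ ((pathGradient_congr_ae (Lp.coeFn_smul c f) k).trans ?_)
        exact ae_of_all _ fun ω => by simp [pathGradient]; ring } 1 fun f => by
    have hg : MemLp (fun ω => (f ω - f (flip k ω)) / 2) 2 P := by
      simpa [div_eq_inv_mul] using ((Lp.memLp f).sub
        ((Lp.memLp f).comp_measurePreserving (measurePreserving_flip k))).const_mul (2⁻¹)
    have heq : ‖(memLp_pathGradient (Lp.memLp f) k).toLp (pathGradient f k)‖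
        = ‖hg.toLp _‖ := by
      rw [Lp.norm_toLp, Lp.norm_toLp]
      congr 1
      refine eLpNorm_congr_norm_ae (ae_of_all _ fun ω => ?_)
      rw [pathGradient_eq, norm_mul, Real.norm_eq_abs (X k ω), abs_X, one_mul]
    have heq2 : hg.toLp _ = (2⁻¹ : ℝ) •
        (f - Lp.compMeasurePreserving (flip k) (measurePreserving_flip k) f) := by
      refine Lp.ext ?_
      filter_upwards [hg.coeFn_toLp, Lp.coeFn_smul (2⁻¹ : ℝ)
        (f - Lp.compMeasurePreserving (flip k) (measurePreserving_flip k) f),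
        Lp.coeFn_sub f (Lp.compMeasurePreserving (flip k) (measurePreserving_flip k) f),
        Lp.coeFn_compMeasurePreserving f (measurePreserving_flip k)] with ω h1 h2 h3 h4
      rw [h1, h2, Pi.smul_apply, h3, Pi.sub_apply, h4, smul_eq_mul, Function.comp]
      ring
    simp only [LinearMap.coe_mk, AddHom.coe_mk, one_mul]
    rw [heq, heq2, norm_smul]
    have := norm_sub_le f (Lp.compMeasurePreserving (flip k) (measurePreserving_flip k) f)
    rw [Lp.norm_compMeasurePreserving] at this
    norm_num
    linarith

lemma gradLp_toLp {F : Space → ℝ} (hF : MemLp F 2 P) (k : ℕ) :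
    gradLp k (hF.toLp F) = (memLp_pathGradient hF k).toLp (pathGradient F k) :=
  MemLp.toLp_congr (memLp_pathGradient (Lp.memLp (hF.toLp F)) k) _
    (pathGradient_congr_ae hF.coeFn_toLp k)

lemma pathGradient_walshSet (A : Finset ℕ) (k : ℕ) (ω : Space) :
    pathGradient (walshSet A) k ω = if k ∈ A then walshSet (A.erase k) ω else 0 := by
  rw [pathGradient_eq, walshSet_flip]
  split_ifs with h
  · rw [← X_mul_walshSet h]; ring
  · simp

lemma gradLp_walshLp (A : Finset ℕ) (k : ℕ) :
    gradLp k (walshLp A) = if k ∈ A then walshLp (A.erase k) else 0 := by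
  rw [walshLp, gradLp_toLp]
  split_ifs with h
  · exact MemLp.toLp_congr _ _ (ae_of_all _ fun ω => by rw [pathGradient_walshSet, if_pos h])
  · rw [Lp.eq_zero_iff_ae_eq_zero]
    filter_upwards [(memLp_pathGradient (memLp_walshSet A) k).coeFn_toLp] with ω hω
    rw [hω, pathGradient_walshSet, if_neg h, Pi.zero_apply]

/-- `⟨D_k e_A, D_k G⟩ = 1{k ∈ A} ⟨e_A, G⟩`: the operator `D_k^* D_k` acts on the Walsh functions
as the projection onto those that contain the coordinate `k`. -/
lemma inner_gradLp_walshLp (A : Finset ℕ) (k : ℕ) (g : Lp ℝ 2 P) :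
    inner ℝ (gradLp k (walshLp A)) (gradLp k g)
      = if k ∈ A then inner ℝ (walshLp A) g else 0 := by
  rw [gradLp_walshLp]
  split_ifs with h
  swap; · simp
  have hg := Lp.memLp g
  have hgf := hg.comp_measurePreserving (measurePreserving_flip k)
  have hA := memLp_walshSet A
  obtain ⟨G, hG, rfl⟩ : ∃ (G : Space → ℝ) (hG : MemLp G 2 P), g = hG.toLp G :=
    ⟨g, hg, (Lp.toLp_coeFn g hg).symm⟩
  clear hg hgf
  have hGf := hG.comp_measurePreserving (measurePreserving_flip k)
  rw [gradLp_toLp, walshLp, walshLp, inner_toLp, inner_toLp]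
  have i1 : Integrable (fun ω => walshSet A ω * G ω) P := hA.integrable_mul hG
  have i2 : Integrable (fun ω => walshSet A ω * G (flip k ω)) P := hA.integrable_mul hGf
  have h1 : ∀ ω, walshSet (A.erase k) ω * pathGradient G k ω
      = 2⁻¹ * (walshSet A ω * G ω - walshSet A ω * G (flip k ω)) := by
    intro ω
    rw [pathGradient_eq, ← X_mul_walshSet h]
    linear_combination (walshSet A ω * (G ω - G (flip k ω)) / 2) * X_mul_self k ω
  have h2 : ∫ ω, walshSet A ω * G (flip k ω) ∂P = -∫ ω, walshSet A ω * G ω ∂P := by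
    have hm : AEStronglyMeasurable (fun ω => walshSet A ω * G ω)
      (Measure.map (flip k) P) := by
      rw [(measurePreserving_flip k).map_eq]; exact i1.1
    have := integral_map (measurePreserving_flip k).measurable.aemeasurable hm
    rw [(measurePreserving_flip k).map_eq] at this
    rw [this, ← integral_neg]
    refine integral_congr_ae (ae_of_all _ fun ω => ?_)
    simp [walshSet_flip, h]
  simp only [h1]
  rw [integral_const_mul, integral_sub i1 i2, h2]
  ring

/-! ### Chaotic decompositions and Walsh expansions -/

lemma _root_.Orthonormal.summable_smul {ι E : Type*} [NormedAddCommGroup E]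
    [InnerProductSpace ℝ E] [CompleteSpace E] {v : ι → E} (hv : Orthonormal ℝ v) {a : ι → ℝ}
    (ha : Summable fun i => a i ^ 2) : Summable fun i => a i • v i := by
  have := (hv.orthogonalFamily.summable_iff_norm_sq_summable (f := a)).2 (by simpa using ha)
  simpa using this

/-- In a series along an orthonormal family, the coefficients are the scalar products with the
sum. -/
lemma _root_.Orthonormal.inner_eq_of_hasSum {ι E : Type*} [NormedAddCommGroup E]
    [InnerProductSpace ℝ E] {v : ι → E} (hv : Orthonormal ℝ v) {a : ι → ℝ} {x : E}
    (h : HasSum (fun i => a i • v i) x) (j : ι) : inner ℝ (v j) x = a j := by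
  classical
  have h1 := h.mapL (innerSL ℝ (v j))
  refine h1.unique ?_
  have h2 := hasSum_single (f := fun i => innerSL ℝ (v j) (a i • v i)) j fun i hi => by
    simp [hv.2 (Ne.symm hi)]
  simpa [inner_smul_right, hv.1 j] using h2

lemma orderEmbedding_eq_of_map_eq {n : ℕ} {i j : Fin n ↪o ℕ}
    (h : Finset.univ.map i.toEmbedding = Finset.univ.map j.toEmbedding) : i = j := by
  refine OrderEmbedding.range_inj.1 ?_
  simpa using congrArg (fun s : Finset ℕ => (s : Set ℕ)) h

/-- Increasing tuples of arbitrary length correspond to finite sets. -/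
def sigmaEquivFinset : (Σ n : ℕ, Fin n ↪o ℕ) ≃ Finset ℕ :=
  Equiv.ofBijective (fun p => Finset.univ.map p.2.toEmbedding) <| by
    refine ⟨?_, fun A => ⟨⟨A.card, A.orderEmbOfFin rfl⟩, ?_⟩⟩
    · rintro ⟨n, i⟩ ⟨m, j⟩ h
      have hc := congrArg Finset.card h
      simp only [Finset.card_map, Finset.card_univ, Fintype.card_fin] at hc
      subst hc
      exact congrArg _ (orderEmbedding_eq_of_map_eq h)
    · simp

lemma sigmaEquivFinset_apply {n : ℕ} (i : Fin n ↪o ℕ) :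
    sigmaEquivFinset ⟨n, i⟩ = Finset.univ.map i.toEmbedding := rfl

lemma J_eq_tsum (n : ℕ) (f : (Fin n → ℕ) → ℝ) :
    J n f = ∑' i : Fin n ↪o ℕ, ((n ! : ℝ) * f i) • walshLp (Finset.univ.map i.toEmbedding) := by
  rw [J, ← tsum_const_smul'']
  refine tsum_congr fun i => ?_
  rw [smul_smul, walshLp]
  congr 1
  exact MemLp.toLp_congr _ _ (ae_of_all _ fun ω => by rw [walsh_eq_walshSet])

lemma J_const_mul (n : ℕ) (c : ℝ) (f : (Fin n → ℕ) → ℝ) :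
    J n (fun i => c * f i) = c • J n f := by
  rw [J_eq_tsum, J_eq_tsum, ← tsum_const_smul'']
  refine tsum_congr fun i => ?_
  rw [smul_smul]
  congr 1
  ring

/-- A Walsh expansion, grouped by the sizes of the index sets, is a chaotic decomposition. -/
lemma hasSum_J_of_hasSum_walshLp {a : Finset ℕ → ℝ} {F : Lp ℝ 2 P}
    (h : HasSum (fun A => a A • walshLp A) F) {f : (n : ℕ) → (Fin n → ℕ) → ℝ}
    (hf : ∀ n (i : Fin n ↪o ℕ), (n ! : ℝ) * f n i = a (Finset.univ.map i.toEmbedding)) :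
    HasSum (fun n => J n (f n)) F := by
  have h' := (sigmaEquivFinset.hasSum_iff).2 h
  refine h'.sigma fun n => ?_
  have hs := (h'.summable.sigma_factor n).hasSum
  convert hs using 1
  rw [J_eq_tsum]
  refine tsum_congr fun i => ?_
  rw [hf]
  rfl

lemma IsKernel.summable_increasing {n : ℕ} {f : (Fin n → ℕ) → ℝ} (hf : IsKernel n f) :
    Summable fun i : Fin n ↪o ℕ => f i ^ 2 :=
  hf.summable_sq.comp_injective (i := fun i : Fin n ↪o ℕ => (i : Fin n → ℕ))
    DFunLike.coe_injective

lemma orthonormal_walshLp_increasing (n : ℕ) :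
    Orthonormal ℝ fun i : Fin n ↪o ℕ => walshLp (Finset.univ.map i.toEmbedding) :=
  orthonormal_walshLp.comp (fun i : Fin n ↪o ℕ => Finset.univ.map i.toEmbedding)
    fun _ _ => orderEmbedding_eq_of_map_eq

lemma hasSum_J {n : ℕ} {f : (Fin n → ℕ) → ℝ} (hf : IsKernel n f) :
    HasSum (fun i : Fin n ↪o ℕ => ((n ! : ℝ) * f i) • walshLp (Finset.univ.map i.toEmbedding))
      (J n f) := by
  rw [J_eq_tsum]
  refine ((orthonormal_walshLp_increasing n).summable_smul ?_).hasSum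
  simpa only [mul_pow] using hf.summable_increasing.mul_left _

lemma inner_walshLp_J_of_card_ne {n : ℕ} {f : (Fin n → ℕ) → ℝ} (hf : IsKernel n f)
    {B : Finset ℕ} (hB : B.card ≠ n) : inner ℝ (walshLp B) (J n f) = 0 := by
  refine ((hasSum_J hf).mapL (innerSL ℝ (walshLp B))).unique ?_
  convert hasSum_zero with i
  have : B ≠ Finset.univ.map i.toEmbedding := fun h => hB (by simp [h])
  simp [orthonormal_walshLp.2 this]

/-- The kernels of a chaotic decomposition of `F` are determined by the Walsh coefficients
of `F`. -/
lemma HasChaos.kernel_eq {F : Space → ℝ} {f : (n : ℕ) → (Fin n → ℕ) → ℝ} (h : HasChaos F f)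
    (hF : MemLp F 2 P) {n : ℕ} (i : Fin n ↪o ℕ) :
    (n ! : ℝ) * f n i = inner ℝ (walshLp (Finset.univ.map i.toEmbedding)) (hF.toLp F) := by
  obtain ⟨hk, _, hs⟩ := h
  have h1 := hs.mapL (innerSL ℝ (walshLp (Finset.univ.map i.toEmbedding)))
  have h2 := (orthonormal_walshLp_increasing n).inner_eq_of_hasSum (hasSum_J (hk n)) i
  rw [← h2]
  refine HasSum.unique ?_ h1
  refine hasSum_single (f := fun m => innerSL ℝ (walshLp (Finset.univ.map i.toEmbedding))
    (J m (f m))) n fun m hm => ?_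
  exact inner_walshLp_J_of_card_ne (hk m) (by simpa using hm.symm)

/-- A functional with a chaotic decomposition is the sum of its Walsh series. -/
lemma HasChaos.hasSum_walshLp {F : Space → ℝ} {f : (n : ℕ) → (Fin n → ℕ) → ℝ}
    (h : HasChaos F f) (hF : MemLp F 2 P) :
    HasSum (fun A => inner ℝ (walshLp A) (hF.toLp F) • walshLp A) (hF.toLp F) := by
  have hsum : Summable fun A => (inner ℝ (walshLp A) (hF.toLp F)) ^ 2 := by
    simpa using orthonormal_walshLp.inner_products_summable (x := hF.toLp F)
  have h1 := (orthonormal_walshLp.summable_smul hsum).hasSum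
  -- the Walsh series converges by Bessel's inequality, and grouping it gives the series of the
  -- chaotic decomposition, whose sum is `F`
  have h2 := hasSum_J_of_hasSum_walshLp h1 (f := f) fun n i => h.kernel_eq hF i
  rwa [h2.unique h.2.2] at h1

lemma IsKernel.exists_increasing {n : ℕ} {f : (Fin n → ℕ) → ℝ} (hf : IsKernel n f)
    {i : Fin n → ℕ} (hi : Function.Injective i) :
    ∃ j : Fin n ↪o ℕ, f j = f i ∧ Finset.univ.map j.toEmbedding = Finset.univ.image i := by
  have hm : StrictMono (i ∘ Tuple.sort i) :=
    (Tuple.monotone_sort i).strictMono_of_injective (hi.comp (Tuple.sort i).injective)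
  refine ⟨OrderEmbedding.ofStrictMono _ hm, hf.symm _ i, ?_⟩
  ext x
  simp only [Finset.mem_map, Finset.mem_image, Finset.mem_univ, true_and]
  exact ((Tuple.sort i).surjective.exists (p := fun a => i a = x)).symm

/-- Kernels of a chaotic decomposition at arbitrary, not necessarily increasing, tuples of distinct
indices. -/
lemma HasChaos.kernel_eq_of_injective {F : Space → ℝ} {f : (n : ℕ) → (Fin n → ℕ) → ℝ}
    (h : HasChaos F f) (hF : MemLp F 2 P) {n : ℕ} {i : Fin n → ℕ} (hi : Function.Injective i) :
    (n ! : ℝ) * f n i = inner ℝ (walshLp (Finset.univ.image i)) (hF.toLp F) := by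
  obtain ⟨j, hj, hij⟩ := (h.1 n).exists_increasing hi
  rw [← hj, h.kernel_eq hF, hij]

lemma HasChaos.unique {F : Space → ℝ} {f g : (n : ℕ) → (Fin n → ℕ) → ℝ} (hf : HasChaos F f)
    (hg : HasChaos F g) : f = g := by
  funext n i
  by_cases hi : Function.Injective i
  · have h := (hf.kernel_eq_of_injective hf.2.1 hi).trans (hg.kernel_eq_of_injective hf.2.1 hi).symm
    exact mul_left_cancel₀ (by positivity) h
  · rw [(hf.1 n).diag i hi, (hg.1 n).diag i hi]

lemma HasChaos.chaosKernel_eq {F : Space → ℝ} {f : (n : ℕ) → (Fin n → ℕ) → ℝ}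
    (hf : HasChaos F f) : chaosKernel F = f := by
  have h : ∃ f, HasChaos F f := ⟨f, hf⟩
  rw [chaosKernel, dif_pos h]
  exact h.choose_spec.unique hf

/-- The number of rearrangements of an increasing tuple is `n!`. -/
lemma IsKernel.factorial_mul_tsum_increasing_le {n : ℕ} {f : (Fin n → ℕ) → ℝ}
    (hf : IsKernel n f) :
    (n ! : ℝ) * ∑' i : Fin n ↪o ℕ, f i ^ 2 ≤ ∑' i, f i ^ 2 := by
  let ρ : Equiv.Perm (Fin n) × (Fin n ↪o ℕ) → (Fin n → ℕ) := fun p => p.2 ∘ p.1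
  have hρ : Function.Injective ρ := by
    rintro ⟨σ, i⟩ ⟨τ, j⟩ h
    have hij : i = j := by
      refine OrderEmbedding.range_inj.1 ?_
      have := congrArg Set.range h
      simpa [ρ, σ.surjective.range_comp, τ.surjective.range_comp] using this
    subst hij
    refine Prod.ext (Equiv.ext fun x => i.injective (congrFun h x)) rfl
  have h1 := tsum_comp_le_tsum_of_inj (f := fun i => f i ^ 2) hf.summable_sq
    (fun i => sq_nonneg _) hρ
  have h2 : ∑' p, f (ρ p) ^ 2 = (n ! : ℝ) * ∑' i : Fin n ↪o ℕ, f i ^ 2 := by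
    have hs := hf.summable_sq.comp_injective hρ
    have : ∀ p, f (ρ p) ^ 2 = f p.2 ^ 2 := fun p => by rw [hf.symm]
    rw [Summable.tsum_prod (f := fun p => f (ρ p) ^ 2) hs]
    simp only [this, tsum_fintype, Finset.sum_const, Finset.card_univ, Fintype.card_perm,
      Fintype.card_fin, nsmul_eq_mul]
  exact h2 ▸ h1

lemma memLp_of_mem_domD {F : Space → ℝ} (hF : F ∈ domD) : MemLp F 2 P := by
  obtain ⟨f, ⟨_, h, _⟩, _⟩ := hF
  exact h

/-- Membership in the domain of the gradient, in terms of the Walsh coefficients. -/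
lemma summable_card_mul_inner_sq {F : Space → ℝ} (hF : F ∈ domD) (hL : MemLp F 2 P) :
    Summable fun A : Finset ℕ => (A.card : ℝ) * (inner ℝ (walshLp A) (hL.toLp F)) ^ 2 := by
  obtain ⟨f, hf, hs⟩ := hF
  rw [← sigmaEquivFinset.summable_iff]
  have hterm : ∀ (n : ℕ) (i : Fin n ↪o ℕ),
      ((fun A : Finset ℕ => (A.card : ℝ) * (inner ℝ (walshLp A) (hL.toLp F)) ^ 2) ∘
        sigmaEquivFinset) ⟨n, i⟩ = (n : ℝ) * ((n ! : ℝ) ^ 2) * f n i ^ 2 := by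
    intro n i
    simp only [Function.comp, sigmaEquivFinset_apply, ← hf.kernel_eq hL]
    simp only [Finset.card_map, Finset.card_univ, Fintype.card_fin]
    ring
  rw [summable_sigma_of_nonneg (fun p => by simp only [Function.comp]; positivity)]
  simp only [hterm]
  refine ⟨fun n => (hf.1 n).summable_increasing.mul_left _, ?_⟩
  refine hs.of_nonneg_of_le (fun n => tsum_nonneg fun i => by positivity) fun n => ?_
  rw [tsum_mul_left]
  calc (n : ℝ) * (n ! : ℝ) ^ 2 * ∑' i : Fin n ↪o ℕ, f n i ^ 2
      = (n : ℝ) * (n ! : ℝ) * ((n ! : ℝ) * ∑' i : Fin n ↪o ℕ, f n i ^ 2) := by ring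
    _ ≤ _ := mul_le_mul_of_nonneg_left (hf.1 n).factorial_mul_tsum_increasing_le (by positivity)

/-! ### The gradient is the pathwise gradient -/

/-- Removal of `k` from the sets that contain it, and insertion into those that do not. -/
def toggle (k : ℕ) : Equiv.Perm (Finset ℕ) :=
  Function.Involutive.toPerm (fun A => if k ∈ A then A.erase k else insert k A) fun A => by
    by_cases h : k ∈ A <;> simp [h]

lemma toggle_apply (k : ℕ) (A : Finset ℕ) :
    toggle k A = if k ∈ A then A.erase k else insert k A := rfl

/-- On square-integrable functionals with a chaotic decomposition, the gradient defined by
the decomposition is the pathwise gradient. -/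
lemma chaosGradient_eq_gradLp {F : Space → ℝ} {f : (n : ℕ) → (Fin n → ℕ) → ℝ}
    (h : HasChaos F f) (hF : MemLp F 2 P) (k : ℕ) :
    chaosGradient F k = gradLp k (hF.toLp F) := by
  set c : Finset ℕ → ℝ := fun A => inner ℝ (walshLp A) (hF.toLp F) with hc
  have h1 := (h.hasSum_walshLp hF).mapL (gradLp k)
  have h2 := ((toggle k).hasSum_iff).2 h1
  have h3 : HasSum (fun B => (if k ∈ B then 0 else c (insert k B)) • walshLp B)
      (gradLp k (hF.toLp F)) := by
    convert h2 using 1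
    funext B
    simp only [Function.comp, toggle_apply, map_smul, gradLp_walshLp, hc]
    by_cases hB : k ∈ B <;> simp [hB]
  have h4 := hasSum_J_of_hasSum_walshLp h3
    (f := fun n i => ((n : ℝ) + 1) * f (n + 1) (Fin.snoc (α := fun _ => ℕ) i k)) fun n i => by
      have hiff : Function.Injective (Fin.snoc (α := fun _ => ℕ) i k) ↔
          k ∉ Finset.univ.map i.toEmbedding := by
        rw [Fin.snoc_injective_iff]
        simp [i.injective]
      split_ifs with hk
      · rw [(h.1 (n + 1)).diag _ fun hi => hiff.1 hi hk]; simp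
      · have := h.kernel_eq_of_injective hF (hiff.2 hk)
        rw [← mul_assoc, mul_comm (n ! : ℝ)]
        rw [Nat.factorial_succ] at this
        push_cast at this
        rw [this, hc]
        congr 2
        ext x
        simp [Fin.exists_fin_succ', eq_comm, or_comm]
  rw [chaosGradient, h.chaosKernel_eq, ← h4.tsum_eq]
  exact tsum_congr fun n => (J_const_mul _ _ _).symm

/-- The two cases in the definition of the gradient agree almost surely. -/
lemma D_ae_eq_pathGradient (F : Space → ℝ) (k : ℕ) : D F k =ᵐ[P] pathGradient F k := by
  by_cases h : F ∈ domD
  · rw [D, if_pos h]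
    obtain ⟨f, hf, -⟩ := h
    rw [chaosGradient_eq_gradLp hf hf.2.1, gradLp_toLp]
    exact MemLp.coeFn_toLp _
  · rw [D, if_neg h]

/-! ### The pseudo-inverse of the Ornstein–Uhlenbeck operator -/

lemma summable_inv_card_mul_inner_sq (F : Lp ℝ 2 P) :
    Summable fun A : Finset ℕ => (-(A.card : ℝ)⁻¹ * inner ℝ (walshLp A) F) ^ 2 := by
  have hsum : Summable fun A => (inner ℝ (walshLp A) F) ^ 2 := by
    simpa using orthonormal_walshLp.inner_products_summable (x := F)
  refine hsum.of_nonneg_of_le (fun A => sq_nonneg _) fun A => ?_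
  rw [mul_pow, neg_sq]
  refine mul_le_of_le_one_left (sq_nonneg _) (pow_le_one₀ (by positivity) ?_)
  exact Nat.cast_inv_le_one _

/-- `L⁻¹F` lies in the domain of the gradient, and `-1 / |A|` are the factors by which `L⁻¹`
multiplies the Walsh coefficients (`0` for `A = ∅`). -/
lemma Linv_spec {F : Space → ℝ} (hF : F ∈ domD) (hL : MemLp F 2 P) :
    Linv F ∈ domD ∧ ∃ h : MemLp (Linv F) 2 P,
      HasSum (fun A : Finset ℕ =>
        (-(A.card : ℝ)⁻¹ * inner ℝ (walshLp A) (hL.toLp F)) • walshLp A) (h.toLp (Linv F)) := by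
  obtain ⟨f, hf, hs⟩ := hF
  have h1 := (orthonormal_walshLp.summable_smul
    (summable_inv_card_mul_inner_sq (hL.toLp F))).hasSum
  set L : Lp ℝ 2 P := ∑' A : Finset ℕ,
    (-(A.card : ℝ)⁻¹ * inner ℝ (walshLp A) (hL.toLp F)) • walshLp A
  -- the convention `0⁻¹ = 0` removes the kernel of order `0`
  let g : (n : ℕ) → (Fin n → ℕ) → ℝ := fun n i => -(n : ℝ)⁻¹ * f n i
  have h2 : HasSum (fun n => J n (g n)) L := hasSum_J_of_hasSum_walshLp h1 fun n i => by
    rw [← hf.kernel_eq hL]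
    simp only [g, Finset.card_map, Finset.card_univ, Fintype.card_fin]
    ring
  have hg : ∀ n, J n (g n) = -(n : ℝ)⁻¹ • J n (f n) := fun n => J_const_mul n _ _
  have h3 : Linv F = ⇑L := by
    have h4 := (hasSum_nat_add_iff' 1).2 h2
    rw [Finset.sum_range_one, hg 0] at h4
    simp only [Nat.cast_zero, inv_zero, neg_zero, zero_smul, sub_zero] at h4
    rw [Linv, hf.chaosKernel_eq, ← tsum_neg, ← h4.tsum_eq]
    refine congrArg (fun u : Lp ℝ 2 P => (u : Space → ℝ)) (tsum_congr fun n => ?_)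
    rw [hg, ← neg_smul]
    push_cast
    rw [one_div]
  have hm : MemLp (Linv F) 2 P := h3 ▸ Lp.memLp L
  have hmL : hm.toLp (Linv F) = L := by
    have : ∀ (G : Space → ℝ) (hG : MemLp G 2 P), G = ⇑L → hG.toLp G = L := by
      rintro G hG rfl
      exact Lp.toLp_coeFn L _
    exact this _ hm h3
  have hgs : ∀ n, (fun i => g n i ^ 2) = fun i => (-(n : ℝ)⁻¹) ^ 2 * f n i ^ 2 := fun n => by
    funext i; simp only [g, mul_pow]
  refine ⟨⟨g, ⟨fun n => ⟨?_, ?_, ?_⟩, hm, hmL ▸ h2⟩, ?_⟩, hm, hmL ▸ h1⟩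
  · rw [hgs]; exact (hf.1 n).summable_sq.mul_left _
  · intro σ i; simp only [g, (hf.1 n).symm]
  · intro i hi; simp only [g, (hf.1 n).diag i hi, mul_zero]
  · refine hs.of_nonneg_of_le
      (fun n => mul_nonneg (by positivity) (tsum_nonneg fun i => sq_nonneg _)) fun n => ?_
    rw [hgs, tsum_mul_left]
    refine mul_le_mul_of_nonneg_left ?_ (by positivity)
    refine mul_le_of_le_one_left (tsum_nonneg fun i => sq_nonneg _) ?_
    rw [neg_sq]
    exact pow_le_one₀ (by positivity) (Nat.cast_inv_le_one _)

/-! ### Integration by parts -/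

/-- Summation over the pairs `k ∈ A` in both orders. -/
lemma hasSum_tsum_ite_mem {u : Finset ℕ → ℝ}
    (hu : Summable fun A => (A.card : ℝ) * |u A|) :
    HasSum (fun k : ℕ => ∑' A : Finset ℕ, if k ∈ A then u A else 0)
      (∑' A : Finset ℕ, (A.card : ℝ) * u A) := by
  have hfib : ∀ (v : Finset ℕ → ℝ) (A : Finset ℕ),
      HasSum (fun k => if k ∈ A then v A else 0) ((A.card : ℝ) * v A) := by
    intro v A
    have : HasSum (fun k => if k ∈ A then v A else 0) (∑ k ∈ A, if k ∈ A then v A else 0) :=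
      hasSum_sum_of_ne_finset_zero fun k hk => if_neg hk
    convert this using 1
    rw [Finset.sum_ite_mem, Finset.inter_self, Finset.sum_const, nsmul_eq_mul]
  have habs : Summable fun p : Finset ℕ × ℕ => |if p.2 ∈ p.1 then u p.1 else 0| := by
    have heq : ∀ (A : Finset ℕ) (k : ℕ),
        |if k ∈ A then u A else 0| = if k ∈ A then |u A| else 0 := fun A k => by
      split_ifs <;> simp
    rw [summable_prod_of_nonneg fun p => abs_nonneg _]
    simp only [heq]
    refine ⟨fun A => (hfib (fun A => |u A|) A).summable, ?_⟩
    simpa only [(hfib (fun A => |u A|) _).tsum_eq] using hu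
  have hs : Summable fun p : Finset ℕ × ℕ => if p.2 ∈ p.1 then u p.1 else 0 := habs.of_abs
  have h1 := hs.hasSum.prod_fiberwise fun A => hfib u A
  have hs' := hs.prod_symm
  have h2 := hs'.hasSum.prod_fiberwise fun k => (hs'.prod_factor k).hasSum
  rw [h1.tsum_eq]
  have h3 : ∑' p : ℕ × Finset ℕ, (if p.swap.2 ∈ p.swap.1 then u p.swap.1 else 0)
      = ∑' p : Finset ℕ × ℕ, if p.2 ∈ p.1 then u p.1 else 0 :=
    (Equiv.prodComm ℕ (Finset ℕ)).tsum_eq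
      (fun p : Finset ℕ × ℕ => if p.2 ∈ p.1 then u p.1 else 0)
  rw [h3] at h2
  exact h2

/-- `∑_k ⟨D_k F, D_k G⟩ = ∑_A |A| a_A ⟨X_A, G⟩` for `F = ∑_A a_A X_A`. -/
lemma hasSum_inner_gradLp {a : Finset ℕ → ℝ} {F G : Lp ℝ 2 P}
    (hF : HasSum (fun A => a A • walshLp A) F)
    (hs : Summable fun A : Finset ℕ => (A.card : ℝ) * |a A * inner ℝ (walshLp A) G|) :
    HasSum (fun k => inner ℝ (gradLp k F) (gradLp k G))
      (∑' A : Finset ℕ, (A.card : ℝ) * (a A * inner ℝ (walshLp A) G)) := by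
  convert hasSum_tsum_ite_mem hs using 1
  funext k
  have h := (hF.mapL (gradLp k)).mapL (innerSL ℝ (gradLp k G))
  simp only [map_smul, innerSL_apply_apply, smul_eq_mul] at h
  rw [real_inner_comm, ← h.tsum_eq]
  refine tsum_congr fun A => ?_
  rw [real_inner_comm, inner_gradLp_walshLp]
  split_ifs <;> simp

lemma integral_pathGradient_mul {F G : Space → ℝ} (hF : MemLp F 2 P) (hG : MemLp G 2 P) (k : ℕ) :
    ∫ ω, pathGradient F k ω * pathGradient G k ω ∂P
      = inner ℝ (gradLp k (hF.toLp F)) (gradLp k (hG.toLp G)) := by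
  rw [gradLp_toLp, gradLp_toLp, inner_toLp]

/-- The gradient of an element of the domain is square-integrable over `Ω × ℕ`. -/
lemma summable_integral_pathGradient_sq {F : Space → ℝ} (hF : F ∈ domD) :
    Summable fun k => ∫ ω, pathGradient F k ω ^ 2 ∂P := by
  have hL := memLp_of_mem_domD hF
  have hs : HasSum (fun A => inner ℝ (walshLp A) (hL.toLp F) • walshLp A) (hL.toLp F) := by
    obtain ⟨f, hf, -⟩ := hF
    exact hf.hasSum_walshLp hL
  have := (hasSum_inner_gradLp (G := hL.toLp F) hs (by
    simpa only [← pow_two, abs_sq] using summable_card_mul_inner_sq hF hL)).summable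
  simpa only [← integral_pathGradient_mul hL hL, ← pow_two] using this

/-- Integration by parts: `E[F G] = E⟨DG, -DL⁻¹F⟩` for centred `F`. -/
lemma hasSum_integral_pathGradient_Linv {F G : Space → ℝ} (hF : F ∈ domD)
    (hmean : ∫ ω, F ω ∂P = 0) (hG : MemLp G 2 P) :
    HasSum (fun k => ∫ ω, pathGradient (Linv F) k ω * pathGradient G k ω ∂P)
      (-∫ ω, F ω * G ω ∂P) := by
  have hL := memLp_of_mem_domD hF
  obtain ⟨-, hm, hs⟩ := Linv_spec hF hL
  have hw : HasSum (fun A => inner ℝ (walshLp A) (hL.toLp F) • walshLp A) (hL.toLp F) := by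
    obtain ⟨f, hf, -⟩ := hF
    exact hf.hasSum_walshLp hL
  have hempty : inner ℝ (walshLp ∅) (hL.toLp F) = (0 : ℝ) := by
    rw [walshLp, inner_toLp]
    simpa [walshSet] using hmean
  have hprod : HasSum (fun A => inner ℝ (walshLp A) (hL.toLp F) *
      inner ℝ (walshLp A) (hG.toLp G)) (inner ℝ (hL.toLp F) (hG.toLp G)) := by
    have := hw.mapL (innerSL ℝ (hG.toLp G))
    simp only [map_smul, innerSL_apply_apply, smul_eq_mul] at this
    rw [real_inner_comm]
    simpa only [real_inner_comm] using this
  have hcard : ∀ A : Finset ℕ, (A.card : ℝ) * (-(A.card : ℝ)⁻¹ *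
      inner ℝ (walshLp A) (hL.toLp F) * inner ℝ (walshLp A) (hG.toLp G))
      = -(inner ℝ (walshLp A) (hL.toLp F) * inner ℝ (walshLp A) (hG.toLp G)) := by
    intro A
    rcases A.eq_empty_or_nonempty with rfl | hA
    · simp [hempty]
    · have : (A.card : ℝ) ≠ 0 := by exact_mod_cast hA.card_ne_zero
      field_simp
  have habs : Summable fun A : Finset ℕ => (A.card : ℝ) * |-(A.card : ℝ)⁻¹ *
      inner ℝ (walshLp A) (hL.toLp F) * inner ℝ (walshLp A) (hG.toLp G)| := by
    refine hprod.summable.abs.congr fun A => ?_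
    rw [← abs_neg, ← hcard, abs_mul, Nat.abs_cast]
  have := hasSum_inner_gradLp hs habs
  simp only [← integral_pathGradient_mul, hcard] at this
  rwa [tsum_neg, hprod.tsum_eq, inner_toLp] at this

/-! ### The standard Gaussian distribution function -/

/-- The standard Gaussian density. -/
def gaussPDF (x : ℝ) : ℝ := gaussianPDFReal 0 1 x

/-- The standard Gaussian distribution function. -/
def gaussCDF (x : ℝ) : ℝ := (gaussianReal 0 1).real (Set.Iic x)

lemma gaussPDF_eq (x : ℝ) : gaussPDF x = (√(2 * Real.pi))⁻¹ * Real.exp (-x ^ 2 / 2) := by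
  simp [gaussPDF, gaussianPDFReal]

lemma gaussPDF_pos (x : ℝ) : 0 < gaussPDF x := gaussianPDFReal_pos 0 1 x one_ne_zero

lemma gaussPDF_neg (x : ℝ) : gaussPDF (-x) = gaussPDF x := by simp [gaussPDF_eq]

lemma hasDerivAt_gaussPDF (x : ℝ) : HasDerivAt gaussPDF (-(x * gaussPDF x)) x := by
  have h1 : HasDerivAt (fun y : ℝ => -y ^ 2 / 2) (-x) x := by
    have := ((hasDerivAt_pow 2 x).neg).div_const 2
    refine HasDerivAt.congr_deriv this ?_
    simp
    ring
  have h2 := (h1.exp).const_mul (√(2 * Real.pi))⁻¹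
  have h3 : gaussPDF = fun y => (√(2 * Real.pi))⁻¹ * Real.exp (-y ^ 2 / 2) :=
    funext gaussPDF_eq
  rw [h3]
  refine h2.congr_deriv ?_
  ring

lemma continuous_gaussPDF : Continuous gaussPDF :=
  continuous_iff_continuousAt.2 fun x => (hasDerivAt_gaussPDF x).continuousAt

lemma tendsto_gaussPDF_atTop : Tendsto gaussPDF atTop (𝓝 0) := by
  have h1 : Tendsto (fun x : ℝ => -x ^ 2 / 2) atTop atBot := by
    have := (tendsto_pow_atTop (α := ℝ) two_ne_zero).atTop_div_const (r := 2) two_pos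
    refine (tendsto_neg_atTop_atBot.comp this).congr fun x => ?_
    simp [neg_div]
  have h2 := (Real.tendsto_exp_atBot.comp h1).const_mul (√(2 * Real.pi))⁻¹
  rw [mul_zero] at h2
  exact h2.congr fun x => (gaussPDF_eq x).symm

lemma gaussCDF_eq_integral (x : ℝ) : gaussCDF x = ∫ t in Set.Iic x, gaussPDF t := by
  rw [gaussCDF, Measure.real, gaussianReal_apply_eq_integral 0 one_ne_zero,
    ENNReal.toReal_ofReal (setIntegral_nonneg measurableSet_Iic fun t _ =>
      gaussianPDFReal_nonneg 0 1 t)]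
  rfl

lemma hasDerivAt_gaussCDF (x : ℝ) : HasDerivAt gaussCDF (gaussPDF x) x := by
  have hint : Integrable gaussPDF := integrable_gaussianPDFReal 0 1
  have h1 : ∀ y, gaussCDF y = gaussCDF 0 + ∫ t in (0 : ℝ)..y, gaussPDF t := by
    intro y
    rw [gaussCDF_eq_integral, gaussCDF_eq_integral, ← intervalIntegral.integral_Iic_sub_Iic
      hint.integrableOn hint.integrableOn]
    ring
  have h2 := (intervalIntegral.integral_hasDerivAt_right
    (continuous_gaussPDF.intervalIntegrable 0 x)
    continuous_gaussPDF.stronglyMeasurable.stronglyMeasurableAtFilter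
    continuous_gaussPDF.continuousAt).const_add (gaussCDF 0)
  exact h2.congr_of_eventuallyEq (Eventually.of_forall h1)

lemma gaussCDF_nonneg (x : ℝ) : 0 ≤ gaussCDF x := measureReal_nonneg

lemma gaussCDF_le_one (x : ℝ) : gaussCDF x ≤ 1 := measureReal_le_one

lemma monotone_gaussCDF : Monotone gaussCDF := fun _ _ h =>
  measureReal_mono (Set.Iic_subset_Iic.2 h)

lemma continuous_gaussCDF : Continuous gaussCDF :=
  continuous_iff_continuousAt.2 fun x => (hasDerivAt_gaussCDF x).continuousAt

lemma tendsto_gaussCDF_atTop : Tendsto gaussCDF atTop (𝓝 1) :=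
  (tendsto_cdf_atTop (gaussianReal 0 1)).congr fun x => cdf_eq_real _ x

lemma gaussCDF_neg (x : ℝ) : gaussCDF (-x) = 1 - gaussCDF x := by
  have hint : Integrable gaussPDF := integrable_gaussianPDFReal 0 1
  have h1 : gaussCDF (-x) = ∫ t in Set.Ioi x, gaussPDF t := by
    rw [gaussCDF_eq_integral, ← integral_comp_neg_Ioi]
    simp only [gaussPDF_neg]
  have h2 : ∫ t, gaussPDF t = 1 := integral_gaussianPDFReal_eq_one 0 one_ne_zero
  have h3 := integral_add_compl (measurableSet_Iic (a := x)) hint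
  rw [Set.compl_Iic, ← gaussCDF_eq_integral, ← h1, h2] at h3
  linarith

/-- The Mills ratio bound: the gap decreases to `0` on the positive half-line. -/
lemma mul_one_sub_gaussCDF_le (x : ℝ) : x * (1 - gaussCDF x) ≤ gaussPDF x := by
  rcases le_or_gt x 0 with hx | hx
  · exact (mul_nonpos_of_nonpos_of_nonneg hx (by linarith [gaussCDF_le_one x])).trans
      (gaussPDF_pos x).le
  have hd : ∀ y : ℝ, 0 < y → HasDerivAt (fun y => gaussPDF y / y - (1 - gaussCDF y))
      (-(gaussPDF y / y ^ 2)) y := by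
    intro y hy
    refine HasDerivAt.congr_deriv (((hasDerivAt_gaussPDF y).div (hasDerivAt_id y) hy.ne').sub
      ((hasDerivAt_gaussCDF y).const_sub 1)) ?_
    simp only [id]
    field_simp
    ring
  have hanti : AntitoneOn (fun y => gaussPDF y / y - (1 - gaussCDF y)) (Set.Ici x) := by
    refine antitoneOn_of_deriv_nonpos (convex_Ici x) ?_ ?_ ?_
    · exact fun y hy => (hd y (hx.trans_le hy)).continuousAt.continuousWithinAt
    · intro y hy
      rw [interior_Ici] at hy
      exact (hd y (hx.trans hy)).differentiableAt.differentiableWithinAt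
    · intro y hy
      rw [interior_Ici] at hy
      rw [(hd y (hx.trans hy)).deriv]
      have := gaussPDF_pos y
      simp only [Left.neg_nonpos_iff]
      positivity
  have hlim : Tendsto (fun y => gaussPDF y / y - (1 - gaussCDF y)) atTop (𝓝 0) := by
    have := (tendsto_gaussPDF_atTop.mul tendsto_inv_atTop_zero).sub
      (tendsto_gaussCDF_atTop.const_sub 1)
    simpa [div_eq_mul_inv] using this
  have h0 : 0 ≤ gaussPDF x / x - (1 - gaussCDF x) :=
    le_of_tendsto hlim (eventually_ge_atTop x |>.mono fun y hy =>
      hanti (Set.mem_Ici.2 le_rfl) hy hy)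
  have := mul_le_mul_of_nonneg_left (sub_nonneg.1 h0) hx.le
  rwa [mul_div_cancel₀ _ hx.ne'] at this

lemma neg_mul_gaussCDF_le (x : ℝ) : -x * gaussCDF x ≤ gaussPDF x := by
  have := mul_one_sub_gaussCDF_le (-x)
  rwa [gaussCDF_neg, sub_sub_cancel, gaussPDF_neg] at this

/-- The difference of the two sides vanishes at `0` and at `∞`; its derivative is the product of
the density and a concave function that vanishes at `0`, so it first increases and then
decreases. -/
lemma gaussCDF_mul_one_sub_le_of_nonneg {x : ℝ} (hx : 0 ≤ x) :
    gaussCDF x * (1 - gaussCDF x) ≤ √(2 * Real.pi) / 4 * gaussPDF x := by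
  set c := √(2 * Real.pi) / 4 with hc
  have hcpos : 0 < c := by positivity
  have hzero : gaussCDF 0 = 1 / 2 := by
    have := gaussCDF_neg 0
    rw [neg_zero] at this
    linarith
  let k : ℝ → ℝ := fun y => c * gaussPDF y - gaussCDF y * (1 - gaussCDF y)
  let m : ℝ → ℝ := fun y => 2 * gaussCDF y - 1 - c * y
  have hk : ∀ y, HasDerivAt k (gaussPDF y * m y) y := by
    intro y
    refine HasDerivAt.congr_deriv (((hasDerivAt_gaussPDF y).const_mul c).sub
      ((hasDerivAt_gaussCDF y).mul ((hasDerivAt_gaussCDF y).const_sub 1))) ?_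
    simp only [m]
    ring
  have hm : ∀ y, HasDerivAt m (2 * gaussPDF y - c) y := by
    intro y
    refine HasDerivAt.congr_deriv
      ((((hasDerivAt_gaussCDF y).const_mul 2).sub_const 1).sub
      ((hasDerivAt_id y).const_mul c)) ?_
    ring
  have hkc : Continuous k := continuous_iff_continuousAt.2 fun y => (hk y).continuousAt
  have hmc : Continuous m := continuous_iff_continuousAt.2 fun y => (hm y).continuousAt
  have hpdf : AntitoneOn gaussPDF (Set.Ici 0) := by
    refine antitoneOn_of_deriv_nonpos (convex_Ici 0) continuous_gaussPDF.continuousOn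
      (fun y _ => (hasDerivAt_gaussPDF y).differentiableAt.differentiableWithinAt) fun y hy => ?_
    rw [interior_Ici] at hy
    rw [(hasDerivAt_gaussPDF y).deriv]
    have := mul_pos hy (gaussPDF_pos y)
    linarith
  have hconc : ConcaveOn ℝ (Set.Ici 0) m := by
    refine AntitoneOn.concaveOn_of_deriv (convex_Ici 0) hmc.continuousOn
      (fun y _ => (hm y).differentiableAt.differentiableWithinAt) ?_
    rw [interior_Ici]
    intro y hy z hz hyz
    rw [(hm y).deriv, (hm z).deriv]
    have := hpdf (Set.mem_Ici.2 (le_of_lt hy)) (Set.mem_Ici.2 (le_of_lt hz)) hyz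
    linarith
  have hm0 : m 0 = 0 := by simp only [m, hzero]; ring
  have hk0 : k 0 = 0 := by
    have : √(2 * Real.pi) ≠ 0 := by positivity
    simp only [k, hzero, gaussPDF_eq, hc]
    field_simp
    norm_num
  have hmin : ∀ s t : ℝ, 0 ≤ s → s ≤ t → min (m 0) (m t) ≤ m s := fun s t hs hst =>
    hconc.min_le_of_mem_Icc (Set.mem_Ici.2 le_rfl) (Set.mem_Ici.2 (hs.trans hst)) ⟨hs, hst⟩
  suffices h : 0 ≤ k x by simpa [k] using h
  rcases le_or_gt 0 (m x) with hmx | hmx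
  · have hmono : MonotoneOn k (Set.Icc 0 x) := by
      refine monotoneOn_of_deriv_nonneg (convex_Icc 0 x) hkc.continuousOn
        (fun y _ => (hk y).differentiableAt.differentiableWithinAt) fun y hy => ?_
      rw [interior_Icc] at hy
      rw [(hk y).deriv]
      refine mul_nonneg (gaussPDF_pos y).le ((le_min ?_ hmx).trans (hmin y x hy.1.le hy.2.le))
      rw [hm0]
    have := hmono ⟨le_rfl, hx⟩ ⟨hx, le_rfl⟩ hx
    rwa [hk0] at this
  · have hanti : AntitoneOn k (Set.Ici x) := by
      refine antitoneOn_of_deriv_nonpos (convex_Ici x) hkc.continuousOn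
        (fun y _ => (hk y).differentiableAt.differentiableWithinAt) fun y hy => ?_
      rw [interior_Ici] at hy
      rw [(hk y).deriv]
      refine mul_nonpos_of_nonneg_of_nonpos (gaussPDF_pos y).le ?_
      by_contra! hmy
      have := hmin x y hx (le_of_lt hy)
      rw [hm0, min_eq_left hmy.le] at this
      linarith
    have hlim : Tendsto k atTop (𝓝 0) := by
      have := (tendsto_gaussPDF_atTop.const_mul c).sub
        (tendsto_gaussCDF_atTop.mul (tendsto_gaussCDF_atTop.const_sub 1))
      simpa using this
    exact le_of_tendsto hlim (eventually_ge_atTop x |>.mono fun y hy =>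
      hanti (Set.mem_Ici.2 le_rfl) hy hy)

lemma gaussCDF_mul_one_sub_le (x : ℝ) :
    gaussCDF x * (1 - gaussCDF x) ≤ √(2 * Real.pi) / 4 * gaussPDF x := by
  rcases le_total 0 x with hx | hx
  · exact gaussCDF_mul_one_sub_le_of_nonneg hx
  · have := gaussCDF_mul_one_sub_le_of_nonneg (neg_nonneg.2 hx)
    rw [gaussCDF_neg, gaussPDF_neg] at this
    linarith

lemma hasDerivAt_gaussCDF_div_gaussPDF (w : ℝ) :
    HasDerivAt (fun w => gaussCDF w / gaussPDF w) (1 + w * (gaussCDF w / gaussPDF w)) w := by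
  have h := (gaussPDF_pos w).ne'
  refine HasDerivAt.congr_deriv ((hasDerivAt_gaussCDF w).div (hasDerivAt_gaussPDF w) h) ?_
  field_simp
  ring

lemma hasDerivAt_one_sub_gaussCDF_div_gaussPDF (w : ℝ) :
    HasDerivAt (fun w => (1 - gaussCDF w) / gaussPDF w)
      (-1 + w * ((1 - gaussCDF w) / gaussPDF w)) w := by
  have h := (gaussPDF_pos w).ne'
  refine HasDerivAt.congr_deriv
    (((hasDerivAt_gaussCDF w).const_sub 1).div (hasDerivAt_gaussPDF w) h) ?_
  field_simp
  ring

lemma mul_one_sub_gaussCDF_div_le (w : ℝ) : w * ((1 - gaussCDF w) / gaussPDF w) ≤ 1 := by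
  rw [← mul_div_assoc, div_le_one (gaussPDF_pos w)]
  exact mul_one_sub_gaussCDF_le w

lemma neg_mul_gaussCDF_div_le (w : ℝ) : -w * (gaussCDF w / gaussPDF w) ≤ 1 := by
  rw [← mul_div_assoc, div_le_one (gaussPDF_pos w)]
  exact neg_mul_gaussCDF_le w

lemma monotone_gaussCDF_div_gaussPDF : Monotone fun w => gaussCDF w / gaussPDF w := by
  refine monotone_of_deriv_nonneg
    (fun w => (hasDerivAt_gaussCDF_div_gaussPDF w).differentiableAt) fun w => ?_
  rw [(hasDerivAt_gaussCDF_div_gaussPDF w).deriv]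
  linarith [neg_mul_gaussCDF_div_le w]

lemma antitone_one_sub_gaussCDF_div_gaussPDF :
    Antitone fun w => (1 - gaussCDF w) / gaussPDF w := by
  refine antitone_of_deriv_nonpos
    (fun w => (hasDerivAt_one_sub_gaussCDF_div_gaussPDF w).differentiableAt) fun w => ?_
  rw [(hasDerivAt_one_sub_gaussCDF_div_gaussPDF w).deriv]
  linarith [mul_one_sub_gaussCDF_div_le w]

/-! ### Stein's equation for the Kolmogorov distance -/

/-- The bounded solution `g` of Stein's equation `g'(w) - w g(w) = 1{w ≤ x} - Φ(x)`. -/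
def stein (x w : ℝ) : ℝ := gaussCDF (min w x) * (1 - gaussCDF (max w x)) / gaussPDF w

/-- The derivative of the Stein solution, with the value at the kink `w = x` that is prescribed by
Stein's equation. -/
def steinDeriv (x w : ℝ) : ℝ := w * stein x w + (if w ≤ x then 1 else 0) - gaussCDF x

lemma stein_of_le {x w : ℝ} (h : w ≤ x) :
    stein x w = gaussCDF w / gaussPDF w * (1 - gaussCDF x) := by
  rw [stein, min_eq_left h, max_eq_right h]
  ring

lemma stein_of_ge {x w : ℝ} (h : x ≤ w) :
    stein x w = gaussCDF x * ((1 - gaussCDF w) / gaussPDF w) := by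
  rw [stein, min_eq_right h, max_eq_left h]
  ring

lemma continuous_stein (x : ℝ) : Continuous (stein x) := by
  unfold stein
  refine Continuous.div ?_ continuous_gaussPDF fun w => (gaussPDF_pos w).ne'
  exact (continuous_gaussCDF.comp (by fun_prop)).mul
    (continuous_const.sub (continuous_gaussCDF.comp (by fun_prop)))

lemma measurable_steinDeriv (x : ℝ) : Measurable (steinDeriv x) := by
  unfold steinDeriv
  exact ((measurable_id.mul (continuous_stein x).measurable).add
    (Measurable.ite measurableSet_Iic measurable_const measurable_const)).sub measurable_const

lemma stein_nonneg (x w : ℝ) : 0 ≤ stein x w :=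
  div_nonneg (mul_nonneg (gaussCDF_nonneg _) (sub_nonneg.2 (gaussCDF_le_one _)))
    (gaussPDF_pos w).le

/-- The Stein solution is largest at the kink `w = x`. -/
lemma stein_le (x w : ℝ) : stein x w ≤ √(2 * Real.pi) / 4 := by
  have hx : gaussCDF x / gaussPDF x * (1 - gaussCDF x) ≤ √(2 * Real.pi) / 4 := by
    rw [div_mul_eq_mul_div, div_le_iff₀ (gaussPDF_pos x)]
    exact gaussCDF_mul_one_sub_le x
  refine le_trans ?_ hx
  rcases le_total w x with h | h
  · rw [stein_of_le h]
    exact mul_le_mul_of_nonneg_right (monotone_gaussCDF_div_gaussPDF h)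
      (sub_nonneg.2 (gaussCDF_le_one x))
  · rw [stein_of_ge h, div_mul_eq_mul_div, mul_div_assoc]
    exact mul_le_mul_of_nonneg_left (antitone_one_sub_gaussCDF_div_gaussPDF h) (gaussCDF_nonneg x)

lemma abs_mul_stein_add_one_sub_le {x w : ℝ} (h : w ≤ x) :
    |w * stein x w + 1 - gaussCDF x| ≤ 1 := by
  have h1 := neg_mul_gaussCDF_div_le w
  have h2 := mul_one_sub_gaussCDF_div_le w
  have hx1 := gaussCDF_le_one x
  have hw0 := gaussCDF_nonneg w
  have hwx := monotone_gaussCDF h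
  have hr : 0 ≤ gaussCDF w / gaussPDF w := div_nonneg hw0 (gaussPDF_pos w).le
  rw [stein_of_le h]
  set r := gaussCDF w / gaussPDF w with hr_def
  rw [abs_le]
  constructor
  · nlinarith
  · have key : w * r * (1 - gaussCDF x) ≤ gaussCDF x := by
      rcases le_total w 0 with hw | hw
      · exact (mul_nonpos_of_nonpos_of_nonneg (mul_nonpos_of_nonpos_of_nonneg hw hr)
          (by linarith)).trans (gaussCDF_nonneg x)
      · calc w * r * (1 - gaussCDF x) ≤ w * r * (1 - gaussCDF w) :=
              mul_le_mul_of_nonneg_left (by linarith) (mul_nonneg hw hr)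
          _ = gaussCDF w * (w * ((1 - gaussCDF w) / gaussPDF w)) := by rw [hr_def]; ring
          _ ≤ gaussCDF w := mul_le_of_le_one_right hw0 h2
          _ ≤ gaussCDF x := hwx
    linarith

lemma abs_mul_stein_sub_le {x w : ℝ} (h : x ≤ w) : |w * stein x w - gaussCDF x| ≤ 1 := by
  have h1 := neg_mul_gaussCDF_div_le w
  have h2 := mul_one_sub_gaussCDF_div_le w
  have hx0 := gaussCDF_nonneg x
  have hw1 := gaussCDF_le_one w
  have hwx := monotone_gaussCDF h
  have hr : 0 ≤ (1 - gaussCDF w) / gaussPDF w :=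
    div_nonneg (sub_nonneg.2 hw1) (gaussPDF_pos w).le
  rw [stein_of_ge h]
  set r := (1 - gaussCDF w) / gaussPDF w with hr_def
  rw [abs_le]
  constructor
  · have key : -w * r * gaussCDF x ≤ 1 - gaussCDF x := by
      rcases le_total 0 w with hw | hw
      · exact (mul_nonpos_of_nonpos_of_nonneg
          (mul_nonpos_of_nonpos_of_nonneg (neg_nonpos.2 hw) hr) hx0).trans
            (sub_nonneg.2 (gaussCDF_le_one x))
      · calc -w * r * gaussCDF x ≤ -w * r * gaussCDF w :=
              mul_le_mul_of_nonneg_left hwx (mul_nonneg (neg_nonneg.2 hw) hr)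
          _ = (1 - gaussCDF w) * (-w * (gaussCDF w / gaussPDF w)) := by rw [hr_def]; ring
          _ ≤ 1 - gaussCDF w := mul_le_of_le_one_right (sub_nonneg.2 hw1) h1
          _ ≤ 1 - gaussCDF x := by linarith
    linarith
  · nlinarith

lemma abs_steinDeriv_le (x w : ℝ) : |steinDeriv x w| ≤ 1 := by
  rw [steinDeriv]
  split_ifs with h
  · exact abs_mul_stein_add_one_sub_le h
  · simpa using abs_mul_stein_sub_le (not_le.1 h).le

/-- Subtracting the primitive of `1{w ≤ x} - Φ(x)` from the Stein solution removes its kink. -/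
lemma hasDerivAt_stein_sub (x w : ℝ) :
    HasDerivAt (fun w => stein x w - min w x + gaussCDF x * w) (w * stein x w) w := by
  have hl : ∀ w, HasDerivAt (fun w => gaussCDF w / gaussPDF w * (1 - gaussCDF x) - w
      + gaussCDF x * w) (w * (gaussCDF w / gaussPDF w * (1 - gaussCDF x))) w := by
    intro w
    refine HasDerivAt.congr_deriv
      ((((hasDerivAt_gaussCDF_div_gaussPDF w).mul_const (1 - gaussCDF x)).sub
      (hasDerivAt_id w)).add ((hasDerivAt_id w).const_mul (gaussCDF x))) ?_
    ring
  have hr : ∀ w, HasDerivAt (fun w => gaussCDF x * ((1 - gaussCDF w) / gaussPDF w) - x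
      + gaussCDF x * w) (w * (gaussCDF x * ((1 - gaussCDF w) / gaussPDF w))) w := by
    intro w
    refine HasDerivAt.congr_deriv
      ((((hasDerivAt_one_sub_gaussCDF_div_gaussPDF w).const_mul (gaussCDF x)).sub_const
      x).add ((hasDerivAt_id w).const_mul (gaussCDF x))) ?_
    ring
  rcases lt_trichotomy w x with h | h | h
  · rw [stein_of_le h.le]
    refine (hl w).congr_of_eventuallyEq ?_
    filter_upwards [Iio_mem_nhds h] with v hv
    rw [stein_of_le (le_of_lt hv), min_eq_left (le_of_lt hv)]
  · subst h
    have h1 : HasDerivWithinAt (fun v => stein w v - min v w + gaussCDF w * v)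
        (w * stein w w) (Set.Iic w) w := by
      rw [stein_of_le le_rfl]
      refine (hl w).hasDerivWithinAt.congr (fun v hv => ?_) ?_
      · rw [stein_of_le hv, min_eq_left hv]
      · rw [stein_of_le le_rfl, min_self]
    have h2 : HasDerivWithinAt (fun v => stein w v - min v w + gaussCDF w * v)
        (w * stein w w) (Set.Ici w) w := by
      rw [stein_of_ge le_rfl]
      refine (hr w).hasDerivWithinAt.congr (fun v hv => ?_) ?_
      · rw [stein_of_ge hv, min_eq_right hv]
      · rw [stein_of_ge le_rfl, min_self]
    have h3 := h1.union h2
    rwa [Set.Iic_union_Ici, hasDerivWithinAt_univ] at h3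
  · rw [stein_of_ge h.le]
    refine (hr w).congr_of_eventuallyEq ?_
    filter_upwards [Ioi_mem_nhds h] with v hv
    rw [stein_of_ge (le_of_lt hv), min_eq_right (le_of_lt hv)]

/-- The right derivative of `w ↦ min w x`, also at the kink. -/
lemma hasDerivWithinAt_min (x w : ℝ) :
    HasDerivWithinAt (fun w => min w x) (if w < x then 1 else 0) (Set.Ici w) w := by
  split_ifs with h
  · refine ((hasDerivAt_id w).congr_of_eventuallyEq ?_).hasDerivWithinAt
    filter_upwards [Iio_mem_nhds h] with v hv
    exact min_eq_left (le_of_lt hv)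
  · refine (hasDerivWithinAt_const w _ x).congr (fun v hv => ?_) ?_
    · exact min_eq_right ((not_lt.1 h).trans hv)
    · exact min_eq_right (not_lt.1 h)

lemma abs_stein_sub_stein_le (x a b : ℝ) : |stein x b - stein x a| ≤ |b - a| := by
  wlog hab : a ≤ b generalizing a b
  · rw [abs_sub_comm, abs_sub_comm b]
    exact this b a (le_of_not_ge hab)
  have h := norm_image_sub_le_of_norm_deriv_right_le_segment (f := stein x) (a := a) (b := b)
    (f' := fun w => w * stein x w + (if w < x then 1 else 0) - gaussCDF x) (C := 1)
    (continuous_stein x).continuousOn (fun w _ => ?_) (fun w _ => ?_) b ⟨hab, le_rfl⟩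
  · rw [one_mul, Real.norm_eq_abs] at h
    rwa [abs_of_nonneg (sub_nonneg.2 hab)]
  · have h1 := ((hasDerivAt_stein_sub x w).hasDerivWithinAt (s := Set.Ici w)).add
      (hasDerivWithinAt_min x w)
    have h2 := h1.sub (((hasDerivAt_id w).const_mul (gaussCDF x)).hasDerivWithinAt
      (s := Set.Ici w))
    convert h2 using 1
    · funext v; simp; ring
    · ring
  · rw [Real.norm_eq_abs]
    split_ifs with hw
    · exact abs_mul_stein_add_one_sub_le hw.le
    · simpa using abs_mul_stein_sub_le (not_lt.1 hw)

lemma abs_mul_stein_sub_mul_stein_le (x a t : ℝ) :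
    |t * stein x t - a * stein x a| ≤ |t - a| * (√(2 * Real.pi) / 4 + |a|) := by
  have h1 : t * stein x t - a * stein x a
      = (t - a) * stein x t + a * (stein x t - stein x a) := by ring
  have h2 : |(t - a) * stein x t| ≤ |t - a| * (√(2 * Real.pi) / 4) := by
    rw [abs_mul, abs_of_nonneg (stein_nonneg x t)]
    exact mul_le_mul_of_nonneg_left (stein_le x t) (abs_nonneg _)
  have h3 : |a * (stein x t - stein x a)| ≤ |a| * |t - a| := by
    rw [abs_mul]
    exact mul_le_mul_of_nonneg_left (abs_stein_sub_stein_le x a t) (abs_nonneg _)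
  rw [h1]
  refine (abs_add_le _ _).trans ?_
  linarith

/-- A first-order Taylor estimate; the Lipschitz bound on the derivative `h` is only needed from
the base point `a`. -/
lemma abs_taylor_one_le {H h : ℝ → ℝ} {a C : ℝ} (hH : ∀ t, HasDerivAt H (h t) t)
    (hC : ∀ t, |h t - h a| ≤ |t - a| * C) (b : ℝ) :
    |H b - H a - (b - a) * h a| ≤ (b - a) ^ 2 / 2 * C := by
  -- the segment from `a` to `b` is parametrized by `[0, 1]`, which covers `b < a` as well
  let ψ : ℝ → ℝ := fun s => H (a + s * (b - a)) - H a - s * (b - a) * h a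
  have hψ : ∀ s, HasDerivAt ψ ((b - a) * (h (a + s * (b - a)) - h a)) s := by
    intro s
    have hin : HasDerivAt (fun s : ℝ => a + s * (b - a)) (b - a) s := by
      simpa using ((hasDerivAt_id s).mul_const (b - a)).const_add a
    have h1 := (hH (a + s * (b - a))).comp s hin
    have h2 : HasDerivAt (fun s : ℝ => s * (b - a) * h a) ((b - a) * h a) s := by
      simpa using ((hasDerivAt_id s).mul_const (b - a)).mul_const (h a)
    refine HasDerivAt.congr_deriv ((h1.sub_const (H a)).sub h2) ?_
    ring
  have hB : ∀ s : ℝ, HasDerivAt (fun s : ℝ => (b - a) ^ 2 / 2 * C * s ^ 2)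
      ((b - a) ^ 2 * C * s) s := by
    intro s
    refine HasDerivAt.congr_deriv ((hasDerivAt_pow 2 s).const_mul ((b - a) ^ 2 / 2 * C)) ?_
    simp
    ring
  have key := image_norm_le_of_norm_deriv_right_le_deriv_boundary (f := ψ) (a := 0) (b := 1)
    (fun s _ => (hψ s).continuousAt.continuousWithinAt)
    (fun s _ => (hψ s).hasDerivWithinAt) (by simp [ψ]) hB (fun s hs => by
      rw [Real.norm_eq_abs, abs_mul]
      refine (mul_le_mul_of_nonneg_left (hC _) (abs_nonneg _)).trans ?_
      rw [add_sub_cancel_left, abs_mul, abs_of_nonneg hs.1, ← sq_abs (b - a)]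
      exact le_of_eq (by ring)) (Set.right_mem_Icc.2 zero_le_one)
  simpa [ψ] using key

/-- The Taylor remainder of the Stein solution: the smooth part of its derivative contributes a
quadratic term, the jump a term that vanishes unless `x` separates `a` and `b`. -/
lemma abs_stein_taylor_le (x a b : ℝ) :
    |stein x b - stein x a - (b - a) * steinDeriv x a| ≤
      (b - a) ^ 2 / 2 * (√(2 * Real.pi) / 4 + |a|) +
        (b - a) * ((if x < b then 1 else 0) - (if x < a then 1 else 0)) := by
  have h1 := abs_taylor_one_le (fun t => hasDerivAt_stein_sub x t)
    (abs_mul_stein_sub_mul_stein_le x a) b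
  have h2 : |min b x - min a x - (b - a) * (if a ≤ x then 1 else 0)| ≤
      (b - a) * ((if x < b then 1 else 0) - (if x < a then 1 else 0)) := by
    rw [abs_le]
    rcases le_or_gt a x with ha | ha <;> rcases le_or_gt b x with hb | hb
    · simp [ha, hb, not_lt.2 ha, not_lt.2 hb]
    · simp only [ha, min_eq_left, not_lt.2 ha, hb, min_eq_right hb.le, if_true, if_false]
      constructor <;> linarith
    · simp only [not_le.2 ha, min_eq_right ha.le, hb, min_eq_left, not_lt.2 hb, ha, if_true,
        if_false]
      constructor <;> linarith
    · simp [not_le.2 ha, ha, hb, min_eq_right ha.le, min_eq_right hb.le]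
  have h3 : stein x b - stein x a - (b - a) * steinDeriv x a
      = (stein x b - min b x + gaussCDF x * b - (stein x a - min a x + gaussCDF x * a)
          - (b - a) * (a * stein x a))
        + (min b x - min a x - (b - a) * (if a ≤ x then 1 else 0)) := by
    rw [steinDeriv]; ring
  rw [h3]
  exact (abs_add_le _ _).trans (add_le_add h1 h2)

/-! ### The chain rule and the Berry–Esseen bound -/

lemma indGt_apply (F : Space → ℝ) (x : ℝ) (ω : Space) :
    indGt F x ω = if x < F ω then 1 else 0 := by
  simp [indGt, Set.indicator_apply]

/-- A functional and its level indicators have gradients of the same sign. -/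
lemma pathGradient_mul_indGt_nonneg (F : Space → ℝ) (x : ℝ) (k : ℕ) (ω : Space) :
    0 ≤ pathGradient F k ω * pathGradient (indGt F x) k ω := by
  simp only [pathGradient, indGt_apply]
  split_ifs with h1 h2 h2
  · simp
  · have : 0 ≤ F (Function.update ω k 1) - F (Function.update ω k (-1)) := by linarith
    norm_num
    linarith
  · have : F (Function.update ω k 1) - F (Function.update ω k (-1)) ≤ 0 := by linarith
    norm_num
    linarith
  · simp

/-- The remainder `R_k = D_k g(F) - g'(F) D_k F` in the discrete chain rule for the Stein
solution `g`. -/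
def chainRemainder (F : Space → ℝ) (x : ℝ) (k : ℕ) (ω : Space) : ℝ :=
  pathGradient (fun ω => stein x (F ω)) k ω - steinDeriv x (F ω) * pathGradient F k ω

lemma abs_chainRemainder_le (F : Space → ℝ) (x : ℝ) (k : ℕ) (ω : Space) :
    |chainRemainder F x k ω| ≤ pathGradient F k ω ^ 2 * (√(2 * Real.pi) / 4 + |F ω|) +
      2 * (pathGradient F k ω * pathGradient (indGt F x) k ω) := by
  have h := abs_stein_taylor_le x (F ω) (F (flip k ω))
  have h1 : chainRemainder F x k ω = -(X k ω / 2) * (stein x (F (flip k ω)) - stein x (F ω)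
      - (F (flip k ω) - F ω) * steinDeriv x (F ω)) := by
    rw [chainRemainder, pathGradient_eq, pathGradient_eq]; ring
  have hX := X_mul_self k ω
  have h2 : pathGradient F k ω ^ 2 = (F (flip k ω) - F ω) ^ 2 / 4 := by
    rw [pathGradient_eq]
    linear_combination ((F (flip k ω) - F ω) ^ 2 / 4) * hX
  have h3 : pathGradient F k ω * pathGradient (indGt F x) k ω = (F (flip k ω) - F ω) *
      ((if x < F (flip k ω) then 1 else 0) - (if x < F ω then 1 else 0)) / 4 := by
    rw [pathGradient_eq, pathGradient_eq, indGt_apply, indGt_apply]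
    linear_combination ((F (flip k ω) - F ω) *
      ((if x < F (flip k ω) then 1 else 0) - (if x < F ω then 1 else 0)) / 4) * hX
  rw [h1, abs_mul, abs_neg, abs_div, abs_X, h2, h3, abs_two]
  linarith

lemma integrable_pathGradient_mul {F G : Space → ℝ} (hF : MemLp F 2 P) (hG : MemLp G 2 P)
    (k : ℕ) : Integrable (fun ω => pathGradient F k ω * pathGradient G k ω) P :=
  (memLp_pathGradient hF k).integrable_mul (memLp_pathGradient hG k)

/-- The series `⟨DF, DG⟩` converges in `L¹(P)`. -/
lemma summable_integral_norm_pathGradient_mul {F G : Space → ℝ} (hF : F ∈ domD) (hG : G ∈ domD) :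
    Summable fun k => ∫ ω, ‖pathGradient F k ω * pathGradient G k ω‖ ∂P := by
  have hLF := memLp_of_mem_domD hF
  have hLG := memLp_of_mem_domD hG
  refine ((summable_integral_pathGradient_sq hF).add
    (summable_integral_pathGradient_sq hG)).of_nonneg_of_le
    (fun k => integral_nonneg fun ω => norm_nonneg _) fun k => ?_
  have h1 := (memLp_pathGradient hLF k).integrable_sq
  have h2 := (memLp_pathGradient hLG k).integrable_sq
  rw [← integral_add h1 h2]
  refine integral_mono (integrable_pathGradient_mul hLF hLG k).norm (h1.add h2) fun ω => ?_
  simp only [Real.norm_eq_abs, abs_mul]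
  rw [← sq_abs (pathGradient F k ω), ← sq_abs (pathGradient G k ω)]
  nlinarith [sq_nonneg (|pathGradient F k ω| - |pathGradient G k ω|),
    sq_nonneg (|pathGradient F k ω|), sq_nonneg (|pathGradient G k ω|)]

lemma lintegral_tsum_enorm_ne_top {Ω : Type*} [MeasurableSpace Ω] {μ : Measure Ω}
    {f : ℕ → Ω → ℝ} (hf : ∀ k, Integrable (f k) μ)
    (hs : Summable fun k => ∫ ω, ‖f k ω‖ ∂μ) : ∫⁻ ω, ∑' k, ‖f k ω‖ₑ ∂μ ≠ ∞ := by
  rw [lintegral_tsum fun k => (hf k).1.enorm]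
  simp only [← fun k => ofReal_integral_norm_eq_lintegral_enorm (hf k)]
  exact hs.tsum_ofReal_ne_top

lemma ae_summable_of_summable_integral_norm {Ω : Type*} [MeasurableSpace Ω] {μ : Measure Ω}
    {f : ℕ → Ω → ℝ} (hf : ∀ k, Integrable (f k) μ)
    (hs : Summable fun k => ∫ ω, ‖f k ω‖ ∂μ) : ∀ᵐ ω ∂μ, Summable fun k => f k ω := by
  filter_upwards [ae_lt_top' (AEMeasurable.tsum fun k => (hf k).1.enorm)
    (lintegral_tsum_enorm_ne_top hf hs)] with ω hω
  exact (tsum_enorm_ne_top_iff_summable_norm.1 hω.ne).of_norm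

lemma integrable_tsum_of_summable_integral_norm {Ω : Type*} [MeasurableSpace Ω] {μ : Measure Ω}
    {f : ℕ → Ω → ℝ} (hf : ∀ k, Integrable (f k) μ)
    (hs : Summable fun k => ∫ ω, ‖f k ω‖ ∂μ) : Integrable (fun ω => ∑' k, f k ω) μ := by
  refine ⟨?_, ?_⟩
  · refine aestronglyMeasurable_of_tendsto_ae atTop
      (f := fun n ω => ∑ k ∈ Finset.range n, f k ω)
      (fun n => (integrable_finsetSum _ fun k _ => hf k).1) ?_
    filter_upwards [ae_summable_of_summable_integral_norm hf hs] with ω hω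
    exact hω.hasSum.tendsto_sum_nat
  · exact (lintegral_mono fun ω => enorm_tsum_le_tsum_enorm).trans_lt
      (lintegral_tsum_enorm_ne_top hf hs).lt_top

/-- The identity behind the bound: Stein's equation is integrated against the law of `F`, and
`E[F g(F)]` is expanded by integration by parts and the chain rule. -/
lemma hasSum_integral_chainRemainder {F : Space → ℝ} (hF : F ∈ domD)
    (hmean : ∫ ω, F ω ∂P = 0) (x : ℝ) :
    HasSum (fun k => ∫ ω, chainRemainder F x k ω * pathGradient (Linv F) k ω ∂P)
      (P.real {ω | F ω ≤ x} - gaussCDF x - ∫ ω, steinDeriv x (F ω) *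
        (1 - inner2 (fun k => pathGradient F k ω) fun k => -pathGradient (Linv F) k ω) ∂P) := by
  have hL := memLp_of_mem_domD hF
  have hdomL := (Linv_spec hF hL).1
  have hLL := memLp_of_mem_domD hdomL
  have hGm : AEStronglyMeasurable (fun ω => stein x (F ω)) P :=
    (continuous_stein x).comp_aestronglyMeasurable hL.1
  have hG : MemLp (fun ω => stein x (F ω)) 2 P :=
    MemLp.of_bound hGm (√(2 * Real.pi) / 4) (ae_of_all _ fun ω => by
      rw [Real.norm_eq_abs, abs_of_nonneg (stein_nonneg _ _)]
      exact stein_le _ _)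
  have hdm : AEStronglyMeasurable (fun ω => steinDeriv x (F ω)) P :=
    ((measurable_steinDeriv x).comp_aemeasurable hL.1.aemeasurable).aestronglyMeasurable
  have hdb : ∀ᵐ ω ∂P, ‖steinDeriv x (F ω)‖ ≤ 1 := ae_of_all _ fun ω => abs_steinDeriv_le x _
  have hd : Integrable (fun ω => steinDeriv x (F ω)) P :=
    (integrable_const (1 : ℝ)).mono' hdm hdb
  set q : ℕ → Space → ℝ := fun k ω => pathGradient F k ω * pathGradient (Linv F) k ω with hq
  have hqi : ∀ k, Integrable (q k) P := integrable_pathGradient_mul hL hLL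
  have hqs := summable_integral_norm_pathGradient_mul hF hdomL
  have hdq : ∀ k, Integrable (fun ω => steinDeriv x (F ω) * q k ω) P := fun k =>
    (hqi k).bdd_mul hdm hdb
  have hdqs : Summable fun k => ∫ ω, ‖steinDeriv x (F ω) * q k ω‖ ∂P := by
    refine hqs.of_nonneg_of_le (fun k => integral_nonneg fun ω => norm_nonneg _) fun k => ?_
    refine integral_mono (hdq k).norm (hqi k).norm fun ω => ?_
    simp only [norm_mul (steinDeriv x (F ω))]
    exact mul_le_of_le_one_left (norm_nonneg _) (abs_steinDeriv_le x _)
  have h1 := hasSum_integral_of_summable_integral_norm hdq hdqs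
  have h2 := hasSum_integral_pathGradient_Linv hF hmean hG
  have h3 := h2.sub h1
  have hS : ∀ ω, inner2 (fun k => pathGradient F k ω) (fun k => -pathGradient (Linv F) k ω)
      = -∑' k, q k ω := fun ω => by
    simp only [inner2, mul_neg, tsum_neg, hq]
  have hSi : Integrable (fun ω => ∑' k, steinDeriv x (F ω) * q k ω) P :=
    integrable_tsum_of_summable_integral_norm hdq hdqs
  have hFG : Integrable (fun ω => F ω * stein x (F ω)) P := hL.integrable_mul hG
  have hterm : ∀ k, ∫ ω, chainRemainder F x k ω * pathGradient (Linv F) k ω ∂P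
      = ∫ ω, pathGradient (Linv F) k ω * pathGradient (fun ω => stein x (F ω)) k ω ∂P
        - ∫ ω, steinDeriv x (F ω) * q k ω ∂P := by
    intro k
    rw [← integral_sub (integrable_pathGradient_mul hLL hG k) (hdq k)]
    refine integral_congr_ae (ae_of_all _ fun ω => ?_)
    simp only [chainRemainder, hq]
    ring
  have e1 : ∫ ω, steinDeriv x (F ω) *
      (1 - inner2 (fun k => pathGradient F k ω) fun k => -pathGradient (Linv F) k ω) ∂P
      = (∫ ω, steinDeriv x (F ω) ∂P) + ∫ ω, ∑' k, steinDeriv x (F ω) * q k ω ∂P := by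
    rw [← integral_add hd hSi]
    refine integral_congr_ae (ae_of_all _ fun ω => ?_)
    simp only [hS, tsum_mul_left]
    ring
  have hms : NullMeasurableSet {ω | F ω ≤ x} P :=
    hL.1.aemeasurable.nullMeasurable measurableSet_Iic
  have hindi : Integrable ({ω | F ω ≤ x}.indicator (fun _ => (1 : ℝ))) P :=
    (integrable_const (1 : ℝ)).indicator₀ hms
  have hindi' : Integrable (fun ω => {ω | F ω ≤ x}.indicator (fun _ => (1 : ℝ)) ω - gaussCDF x) P :=
    hindi.sub (integrable_const _)
  have hind : ∫ ω, ({ω | F ω ≤ x}.indicator (fun _ => (1 : ℝ)) ω - gaussCDF x) ∂P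
      = P.real {ω | F ω ≤ x} - gaussCDF x := by
    rw [integral_sub hindi (integrable_const _), integral_indicator₀ hms]
    simp
  have e2 : ∫ ω, steinDeriv x (F ω) ∂P
      = (∫ ω, F ω * stein x (F ω) ∂P) + (P.real {ω | F ω ≤ x} - gaussCDF x) := by
    rw [← hind, ← integral_add hFG hindi']
    refine integral_congr_ae (ae_of_all _ fun ω => ?_)
    simp only [steinDeriv, Set.indicator_apply, Set.mem_ofPred_eq]
    ring
  have e3 : P.real {ω | F ω ≤ x} - gaussCDF x - ∫ ω, steinDeriv x (F ω) *
      (1 - inner2 (fun k => pathGradient F k ω) fun k => -pathGradient (Linv F) k ω) ∂P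
      = -(∫ ω, F ω * stein x (F ω) ∂P) - ∫ ω, ∑' k, steinDeriv x (F ω) * q k ω ∂P := by
    rw [e1, e2]
    ring
  simp only [hterm]
  rw [e3]
  exact h3

/-- The bound at a fixed level, in terms of the pathwise gradient. -/
lemma enorm_measureReal_sub_gaussCDF_le {F : Space → ℝ} (hF : F ∈ domD)
    (hmean : ∫ ω, F ω ∂P = 0) (x : ℝ) :
    ‖P.real {ω | F ω ≤ x} - gaussCDF x‖ₑ ≤
      (∫⁻ ω, ENNReal.ofReal |1 - inner2 (fun k => pathGradient F k ω)
          (fun k => -pathGradient (Linv F) k ω)| ∂P)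
      + ∑' k, ∫⁻ ω, ‖chainRemainder F x k ω * pathGradient (Linv F) k ω‖ₑ ∂P := by
  have h := hasSum_integral_chainRemainder hF hmean x
  set I := ∫ ω, steinDeriv x (F ω) *
    (1 - inner2 (fun k => pathGradient F k ω) fun k => -pathGradient (Linv F) k ω) ∂P
  have hdec : P.real {ω | F ω ≤ x} - gaussCDF x = I +
      ∑' k, ∫ ω, chainRemainder F x k ω * pathGradient (Linv F) k ω ∂P := by
    rw [h.tsum_eq]; ring
  rw [hdec]
  refine (enorm_add_le _ _).trans (add_le_add ?_ ?_)
  · refine (enorm_integral_le_lintegral_enorm _).trans (lintegral_mono fun ω => ?_)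
    rw [enorm_mul, ← Real.enorm_eq_ofReal_abs]
    refine mul_le_of_le_one_left zero_le ?_
    rw [Real.enorm_eq_ofReal_abs, ← ENNReal.ofReal_one]
    exact ENNReal.ofReal_le_ofReal (abs_steinDeriv_le x _)
  · refine (enorm_tsum_le_tsum_enorm).trans (ENNReal.tsum_le_tsum fun k => ?_)
    exact enorm_integral_le_lintegral_enorm _

/-- The three sums that dominate the remainder of the chain rule. -/
lemma tsum_lintegral_chainRemainder_le {F : Space → ℝ} (hF : MemLp F 2 P)
    (hLinv : MemLp (Linv F) 2 P) (x : ℝ) :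
    ∑' k, ∫⁻ ω, ‖chainRemainder F x k ω * pathGradient (Linv F) k ω‖ₑ ∂P ≤
      ENNReal.ofReal (√(2 * Real.pi) / 4) *
        (∫⁻ ω, innerNonneg (fun k => pathGradient F k ω ^ 2)
          (fun k => |pathGradient (Linv F) k ω|) ∂P)
      + (∫⁻ ω, innerNonneg (fun k => pathGradient F k ω ^ 2)
          (fun k => |F ω * pathGradient (Linv F) k ω|) ∂P)
      + 2 * ∫⁻ ω, innerNonneg
          (fun k => pathGradient F k ω * pathGradient (indGt F x) k ω)
          (fun k => |pathGradient (Linv F) k ω|) ∂P := by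
  have hu : ∀ k, AEMeasurable (pathGradient F k) P := fun k =>
    (memLp_pathGradient hF k).1.aemeasurable
  have hw : ∀ k, AEMeasurable (fun ω => |pathGradient (Linv F) k ω|) P := fun k =>
    (memLp_pathGradient hLinv k).1.norm.aemeasurable
  have hind : MemLp (indGt F x) 2 P := by
    have hms : NullMeasurableSet {ω | F ω > x} P :=
      hF.1.aemeasurable.nullMeasurable measurableSet_Ioi
    refine MemLp.of_bound (aestronglyMeasurable_const.indicator₀ hms) 1 (ae_of_all _ fun ω => ?_)
    rw [indGt_apply]
    split_ifs <;> simp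
  have hd : ∀ k, AEMeasurable (pathGradient (indGt F x) k) P := fun k =>
    (memLp_pathGradient hind k).1.aemeasurable
  have m1 : ∀ k, AEMeasurable (fun ω => ENNReal.ofReal (pathGradient F k ω ^ 2 *
      |pathGradient (Linv F) k ω|)) P := fun k => (((hu k).pow_const 2).mul (hw k)).ennreal_ofReal
  have m2 : ∀ k, AEMeasurable (fun ω => ENNReal.ofReal (pathGradient F k ω ^ 2 *
      |F ω * pathGradient (Linv F) k ω|)) P := fun k => by
    simp only [abs_mul]
    exact (((hu k).pow_const 2).mul (hF.1.norm.aemeasurable.mul (hw k))).ennreal_ofReal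
  have m3 : ∀ k, AEMeasurable (fun ω => ENNReal.ofReal (pathGradient F k ω *
      pathGradient (indGt F x) k ω * |pathGradient (Linv F) k ω|)) P := fun k =>
    (((hu k).mul (hd k)).mul (hw k)).ennreal_ofReal
  simp only [innerNonneg]
  rw [lintegral_tsum m1, lintegral_tsum m2, lintegral_tsum m3, ← ENNReal.tsum_mul_left,
    ← ENNReal.tsum_mul_left, ← ENNReal.tsum_add, ← ENNReal.tsum_add]
  refine ENNReal.tsum_le_tsum fun k => ?_
  rw [← lintegral_const_mul'' _ (m1 k), ← lintegral_const_mul'' _ (m3 k),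
    ← lintegral_add_left' ((m1 k).const_mul _), ← lintegral_add_right' _ ((m3 k).const_mul _)]
  refine lintegral_mono fun ω => ?_
  have hsign := pathGradient_mul_indGt_nonneg F x k ω
  have h2 : (2 : ℝ≥0∞) = ENNReal.ofReal 2 := by simp
  rw [h2, ← ENNReal.ofReal_mul (by positivity), ← ENNReal.ofReal_mul (by positivity),
    ← ENNReal.ofReal_add (by positivity) (by positivity),
    ← ENNReal.ofReal_add (by positivity) (by positivity), Real.enorm_eq_ofReal_abs]
  refine ENNReal.ofReal_le_ofReal ?_
  rw [abs_mul, abs_mul]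
  refine (mul_le_mul_of_nonneg_right (abs_chainRemainder_le F x k ω) (abs_nonneg _)).trans
    (le_of_eq ?_)
  ring

end Rademacher

end

theorem mainTheorem1
    (F : Rademacher.Space → ℝ) (hF : F ∈ Rademacher.domD)
    (hmean : ∫ ω, F ω ∂(Rademacher.P) = 0)
    {Ω' : Type*} [MeasurableSpace Ω'] (Q : Measure Ω') [IsProbabilityMeasure Q]
    (N : Ω' → ℝ) (hN : HasLaw N (gaussianReal 0 1) Q) :
    -- the scalar product in the first term is an almost surely convergent series
    (∀ᵐ ω ∂(Rademacher.P), Summable fun k : ℕ =>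
      Rademacher.D F k ω * -Rademacher.D (Rademacher.Linv F) k ω) ∧
    -- the products in the last term are almost surely nonnegative
    (∀ x : ℝ, ∀ᵐ ω ∂(Rademacher.P), ∀ k : ℕ,
      0 ≤ Rademacher.D F k ω * Rademacher.D (Rademacher.indGt F x) k ω) ∧
    -- the bound itself
    ENNReal.ofReal (Rademacher.kolmogorovDist F Rademacher.P N Q) ≤
      (∫⁻ ω, ENNReal.ofReal
          |1 - Rademacher.inner2 (fun k => Rademacher.D F k ω)
            (fun k => -Rademacher.D (Rademacher.Linv F) k ω)| ∂(Rademacher.P))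
      + ENNReal.ofReal (√(2 * Real.pi) / 4) *
        (∫⁻ ω, Rademacher.innerNonneg (fun k => Rademacher.D F k ω ^ 2)
            (fun k => |Rademacher.D (Rademacher.Linv F) k ω|) ∂(Rademacher.P))
      + (∫⁻ ω, Rademacher.innerNonneg (fun k => Rademacher.D F k ω ^ 2)
            (fun k => |F ω * Rademacher.D (Rademacher.Linv F) k ω|) ∂(Rademacher.P))
      + 2 * ⨆ x : ℝ,
        ∫⁻ ω, Rademacher.innerNonneg
            (fun k => Rademacher.D F k ω * Rademacher.D (Rademacher.indGt F x) k ω)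
            (fun k => |Rademacher.D (Rademacher.Linv F) k ω|) ∂(Rademacher.P) := by
  open Rademacher in
  have hL := memLp_of_mem_domD hF
  have hdomL := (Linv_spec hF hL).1
  have hLL := memLp_of_mem_domD hdomL
  have hDF : ∀ᵐ ω ∂P, ∀ k, D F k ω = pathGradient F k ω :=
    ae_all_iff.2 fun k => D_ae_eq_pathGradient F k
  have hDL : ∀ᵐ ω ∂P, ∀ k, D (Linv F) k ω = pathGradient (Linv F) k ω :=
    ae_all_iff.2 fun k => D_ae_eq_pathGradient (Linv F) k
  have hDI : ∀ x, ∀ᵐ ω ∂P, ∀ k, D (indGt F x) k ω = pathGradient (indGt F x) k ω := fun x =>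
    ae_all_iff.2 fun k => D_ae_eq_pathGradient (indGt F x) k
  refine ⟨?_, fun x => ?_, ?_⟩
  · filter_upwards [hDF, hDL, ae_summable_of_summable_integral_norm
      (integrable_pathGradient_mul hL hLL) (summable_integral_norm_pathGradient_mul hF hdomL)]
      with ω h1 h2 h3
    simpa only [h1, h2, mul_neg] using h3.neg
  · filter_upwards [hDF, hDI x] with ω h1 h2 k
    rw [h1, h2]
    exact pathGradient_mul_indGt_nonneg F x k ω
  -- each term of the bound is unchanged when the pathwise gradient replaces `D`
  have e1 : ∫⁻ ω, ENNReal.ofReal |1 - inner2 (fun k => D F k ω)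
        (fun k => -D (Linv F) k ω)| ∂P = ∫⁻ ω, ENNReal.ofReal |1 - inner2
        (fun k => pathGradient F k ω) (fun k => -pathGradient (Linv F) k ω)| ∂P := by
    refine lintegral_congr_ae ?_
    filter_upwards [hDF, hDL] with ω h1 h2
    simp only [h1, h2]
  have e2 : ∫⁻ ω, innerNonneg (fun k => D F k ω ^ 2) (fun k => |D (Linv F) k ω|) ∂P
      = ∫⁻ ω, innerNonneg (fun k => pathGradient F k ω ^ 2)
        (fun k => |pathGradient (Linv F) k ω|) ∂P := by
    refine lintegral_congr_ae ?_
    filter_upwards [hDF, hDL] with ω h1 h2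
    simp only [h1, h2]
  have e3 : ∫⁻ ω, innerNonneg (fun k => D F k ω ^ 2) (fun k => |F ω * D (Linv F) k ω|) ∂P
      = ∫⁻ ω, innerNonneg (fun k => pathGradient F k ω ^ 2)
        (fun k => |F ω * pathGradient (Linv F) k ω|) ∂P := by
    refine lintegral_congr_ae ?_
    filter_upwards [hDF, hDL] with ω h1 h2
    simp only [h1, h2]
  have e4 : ∀ x, ∫⁻ ω, innerNonneg (fun k => D F k ω * D (indGt F x) k ω)
        (fun k => |D (Linv F) k ω|) ∂P
      = ∫⁻ ω, innerNonneg (fun k => pathGradient F k ω * pathGradient (indGt F x) k ω)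
        (fun k => |pathGradient (Linv F) k ω|) ∂P := by
    intro x
    refine lintegral_congr_ae ?_
    filter_upwards [hDF, hDL, hDI x] with ω h1 h2 h3
    simp only [h1, h2, h3]
  simp only [e1, e2, e3, e4]
  have hNx : ∀ x, Q.real {ω | N ω ≤ x} = gaussCDF x := by
    intro x
    rw [gaussCDF, ← hN.map_eq, Measure.real, Measure.real,
      Measure.map_apply_of_aemeasurable hN.aemeasurable measurableSet_Iic]
    rfl
  set B : ℝ≥0∞ := _ + _ + _ + 2 * ⨆ x : ℝ, _
  have hB : ∀ x, ‖P.real {ω | F ω ≤ x} - gaussCDF x‖ₑ ≤ B := by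
    intro x
    refine (enorm_measureReal_sub_gaussCDF_le hF hmean x).trans ?_
    refine (add_le_add_right (tsum_lintegral_chainRemainder_le hL hLL x) _).trans ?_
    rw [← add_assoc, ← add_assoc]
    exact add_le_add_right (mul_le_mul_right (le_iSup (fun x => ∫⁻ ω, innerNonneg
      (fun k => pathGradient F k ω * pathGradient (indGt F x) k ω)
      (fun k => |pathGradient (Linv F) k ω|) ∂P) x) 2) _
  -- `toReal ∞ = 0`, so an infinite bound is treated apart
  rcases eq_or_ne B ∞ with htop | htop
  · rw [htop]; exact le_top
  rw [kolmogorovDist]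
  refine ENNReal.ofReal_le_of_le_toReal (ciSup_le fun x => ?_)
  rw [hNx x]
  have := ENNReal.toReal_mono htop (hB x)
  rwa [Real.enorm_eq_ofReal_abs, ENNReal.toReal_ofReal (abs_nonneg _)] at this
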